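/- **Setting.** Let $L,H,\kappa,\varepsilon_+,\varepsilon_->0$, $\theta\in\mathbb R$, $\Omega=(0,L)\times(-H,H)$, $\Gamma_{\pm H}=(0,L)\times\{\pm H\}$. Let $\varepsilon:\mathbb R^2\to\mathbb C$ be measurable, $L$-periodic in $x_1$, with $\operatorname{Re}\varepsilon\ge c$ for some $c>0$, $\varepsilon=\varepsilon_+$ for $x_2>H$ and $\varepsilon=\varepsilon_-$ for $x_2<-H$. Let $u^{\rm inc}(x)=\exp[i\kappa\sqrt{\varepsilon_+}(x_1\sin\theta-x_2\cos\theta)]$, $\alpha_n=\kappa\sqrt{\varepsilon_+}\sin\theta+2\pi n/L$, and let $\beta_n^\pm=\sqrt{\kappa^2\varepsilon_\pm-\alpha_n^2}$ if $\alpha_n^2<\kappa^2\varepsilon_\pm$, $\beta_n^\pm=i\sqrt{\alpha_n^2-\kappa^2\varepsilon_\pm}$ otherwise. Let $-H=h_0<h_1<\dots<h_S=H$ and $\varepsilon_h(x_1,x_2)=\varepsilon(x_1,\tfrac12(h_{j-1}+h_j))$ for $h_{j-1}<x_2<h_j$, $1\le j\le S$. Let $H^1_{qp}(\Omega)$ be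 the closure in $H^1(\Omega)$ of the smooth functions with $\varphi(x_1+L,x_2)=e^{i\alpha_0L}\varphi(x_1,x_2)$. For $w,v\in H^1_{qp}(\Omega)$ put $$B_{\varepsilon_h}(w,v)=\int_\Omega\Big(\frac1{\varepsilon_h}\nabla w\cdot\nabla\overline v-\kappa^2w\overline v\Big)-\int_{\Gamma_{-H}}\overline v\,T^-w-\int_{\Gamma_H}\overline v\,T^+w,\qquad T^\pm\varphi=\frac{i}{\varepsilon_\pm}\sum_{n\in\mathbb Z}\beta_n^\pm\varphi_n e^{i\alpha_nx_1}$$ for $\varphi=\sum_n\varphi_ne^{i\alpha_nx_1}$, and $$f(v)=-\int_\Omega\nabla\cdot\big[(\varepsilon_+^{-1}-\varepsilon_h^{-1})\nabla u^{\rm inc}\big]\,\overline v ,$$ where the divergence is distributional and the permittivity beyond $\Gamma_{\pm H}$ is $\varepsilon_\pm$, i.e. $$f(v)=\int_\Omega(\varepsilon_+^{-1}-\varepsilon_h^{-1})\nabla u^{\rm inc}\cdot\nabla\overline v+\int_{\Gamma_{-H}}(\varepsilon_+^{-1}-\varepsilon_-^{-1})\,\frac{\partial u^{\rm inc}}{\partial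 x_2}\,\overline v .$$ For $M\ge0$ let $V_M=H^1(-H,H)\otimes\operatorname{span}\{e^{i\alpha_nx_1}:|n|\le M\}\subset H^1_{qp}(\Omega)$. **RCWA solution.** Let $c^{(j)}_k$ be the $k$-th Fourier coefficient of the $L$-periodic function $1/\varepsilon_h$ of $x_1$ in the slice $h_{j-1}<x_2<h_j$, let $f_n$ be the coefficient of $e^{i\alpha_nx_1}$ in $\nabla\cdot[(\varepsilon_+^{-1}-\varepsilon_h^{-1})\nabla u^{\rm inc}]$ inside a slice, and write $u^{\rm inc}=\sum_nu_n^{\rm inc}(x_2)e^{i\alpha_nx_1}$ (so $u^{\rm inc}_n=0$ for $n\ne0$). An RCWA solution is a function $u^{h,M}=\sum_{|n|\le M}u_n(x_2)e^{i\alpha_nx_1}$ with $u_n$ continuous on $[-H,H]$ and $C^2$ on each $[h_{j-1},h_j]$, such that for all $|n|\le M$: 1. in each slice, $\displaystyle\sum_{|m|\le M}c^{(j)}_{n-m}u_m''=\alpha_n\sum_{|m|\le M}c^{(j)}_{n-m}\alpha_mu_m-\kappa^2u_n+f_n$; 2. the total flux $\sum_{|m|\le M}c^{(j)}_{n-m}(u_m+u^{\rm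 inc}_m)'$ is continuous across $x_2=h_1,\dots,h_{S-1}$; 3. on $\Gamma_{H}$, respectively $\Gamma_{-H}$, the total field and the total flux are continuous with $u^{\rm inc}$ plus an outgoing expansion $\sum_{|n|\le M}r_ne^{i\beta_n^+(x_2-H)}e^{i\alpha_nx_1}$ in the medium $\varepsilon_+$, respectively $\sum_{|n|\le M}t_ne^{-i\beta_n^-(x_2+H)}e^{i\alpha_nx_1}$ in the medium $\varepsilon_-$; that is, $u_n(H)=r_n$, the total flux at $H$ is $\varepsilon_+^{-1}((u_n^{\rm inc})'(H)+i\beta_n^+r_n)$, $u_n(-H)=t_n$, and the total flux at $-H$ is $\varepsilon_-^{-1}((u_n^{\rm inc})'(-H)-i\beta_n^-t_n)$. **Theorem.** Every RCWA solution $u^{h,M}$ lies in $V_M$ and satisfies the Galerkin equations $$B_{\varepsilon_h}(u^{h,M},v_M)=f(v_M)\qquad\text{for all }v_M\in V_M .$$ -/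

import Mathlib

open MeasureTheory Filter Topology Complex
open scoped ContDiff ComplexConjugate

noncomputable section

namespace RCWA

/-- The data of the scattering problem. The period cell is `(0,L) × (-H,H)`, `κ` is the wavenumber,
`θ` the angle of incidence, `ε` the relative permittivity, which is the positive constant `εp`
above `x₂ = H` and the positive constant `εm` below `x₂ = -H`. The condition on the real part covers
real permittivities (bounded below by a positive number) as well as dissipative ones. -/
structure Grating where
  L : ℝ
  H : ℝ
  κ : ℝ
  θ : ℝ
  εp : ℝ
  εm : ℝ
  ε : ℝ × ℝ → ℂ
  L_pos : 0 < L
  H_pos : 0 < H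
  κ_pos : 0 < κ
  εp_pos : 0 < εp
  εm_pos : 0 < εm
  measurable_ε : Measurable ε
  periodic_ε : ∀ x₁ x₂ : ℝ, ε (x₁ + L, x₂) = ε (x₁, x₂)
  ε_above : ∀ x₁ x₂ : ℝ, H < x₂ → ε (x₁, x₂) = (εp : ℂ)
  ε_below : ∀ x₁ x₂ : ℝ, x₂ < -H → ε (x₁, x₂) = (εm : ℂ)
  re_ε : ∃ c : ℝ, 0 < c ∧ ∀ x, c ≤ (ε x).re

/-- A mesh `-H = h₀ < h₁ < ⋯ < h_S = H`; the slices are numbered `j = 0, …, S - 1`, slice `j` being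
`h_j < x₂ < h_{j+1}`. -/
structure Mesh (P : Grating) where
  S : ℕ
  node : ℕ → ℝ
  S_pos : 0 < S
  node_zero : node 0 = -P.H
  node_last : node S = P.H
  node_lt : ∀ j, j < S → node j < node (j + 1)

/-- Partial derivative in `x₁`. -/
def pd₁ (φ : ℝ × ℝ → ℂ) (x : ℝ × ℝ) : ℂ := deriv (fun s : ℝ => φ (s, x.2)) x.1

/-- Partial derivative in `x₂`. -/
def pd₂ (φ : ℝ × ℝ → ℂ) (x : ℝ × ℝ) : ℂ := deriv (fun t : ℝ => φ (x.1, t)) x.2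

variable (P : Grating)

/-- The domain `Ω` of one period. -/
def Omega : Set (ℝ × ℝ) := Set.Ioo 0 P.L ×ˢ Set.Ioo (-P.H) P.H

/-- Lebesgue measure on `Ω`. -/
def volΩ : Measure (ℝ × ℝ) := volume.restrict (Omega P)

/-- Lebesgue measure on `(0,L)`, i.e. on either of `Γ_H`, `Γ_{-H}`. -/
def volΓ : Measure ℝ := volume.restrict (Set.Ioo 0 P.L)

/-- `α_n = κ √ε₊ sin θ + 2πn/L`. -/
def α (n : ℤ) : ℝ := P.κ * √P.εp * Real.sin P.θ + n * (2 * Real.pi / P.L)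

/-- `β_n` for the half-space with constant permittivity `e`. -/
def β (e : ℝ) (n : ℤ) : ℂ :=
  if α P n ^ 2 < P.κ ^ 2 * e then (√(P.κ ^ 2 * e - α P n ^ 2) : ℂ)
  else I * (√(α P n ^ 2 - P.κ ^ 2 * e) : ℂ)

/-- The mode `exp(i α_n x₁)`. -/
def mode (n : ℤ) (x₁ : ℝ) : ℂ := exp (I * α P n * x₁)

/-- The `n`-th quasi-periodic Fourier coefficient: `φ = ∑ φ_n exp(i α_n x₁)`. -/
def qpCoeff (n : ℤ) (φ : ℝ → ℂ) : ℂ :=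
  (1 / (P.L : ℂ)) * ∫ x₁ in Set.Ioo 0 P.L, φ x₁ * exp (-(I * α P n * x₁))

/-- The incident plane wave. -/
def uinc (x : ℝ × ℝ) : ℂ :=
  exp (I * P.κ * (√P.εp : ℝ) * (x.1 * Real.sin P.θ - x.2 * Real.cos P.θ))

/-- Smooth functions that are quasi-periodic in `x₁`. -/
def IsSmoothQP (φ : ℝ × ℝ → ℂ) : Prop :=
  ContDiff ℝ ∞ φ ∧ ∀ x₁ x₂ : ℝ, φ (x₁ + P.L, x₂) = exp (I * α P 0 * P.L) * φ (x₁, x₂)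

/-- `H¹_qp(Ω)`, the closure of the smooth quasi-periodic functions in the `H¹(Ω)`-norm. An element is
given by a function `val`, its weak partial derivatives `d₁`, `d₂` and its traces `top`, `bot`
on `Γ_H`, `Γ_{-H}`. These four are determined almost everywhere by `val`, and, the trace operator
being continuous, the convergence of the traces follows from that in the `H¹`-norm. -/
structure H1qp where
  val : ℝ × ℝ → ℂ
  d₁ : ℝ × ℝ → ℂ
  d₂ : ℝ × ℝ → ℂ
  top : ℝ → ℂ
  bot : ℝ → ℂ
  memLp_val : MemLp val 2 (volΩ P)
  memLp_d₁ : MemLp d₁ 2 (volΩ P)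
  memLp_d₂ : MemLp d₂ 2 (volΩ P)
  memLp_top : MemLp top 2 (volΓ P)
  memLp_bot : MemLp bot 2 (volΓ P)
  approx : ∃ φ : ℕ → ℝ × ℝ → ℂ, (∀ k, IsSmoothQP P (φ k)) ∧
    Tendsto (fun k => eLpNorm (φ k - val) 2 (volΩ P)) atTop (𝓝 0) ∧
    Tendsto (fun k => eLpNorm (pd₁ (φ k) - d₁) 2 (volΩ P)) atTop (𝓝 0) ∧
    Tendsto (fun k => eLpNorm (pd₂ (φ k) - d₂) 2 (volΩ P)) atTop (𝓝 0) ∧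
    Tendsto (fun k => eLpNorm ((fun x₁ => φ k (x₁, P.H)) - top) 2 (volΓ P)) atTop (𝓝 0) ∧
    Tendsto (fun k => eLpNorm ((fun x₁ => φ k (x₁, -P.H)) - bot) 2 (volΓ P)) atTop (𝓝 0)

/-- The pairing `∫_Γ conj(ψ) T(φ)` with the Dirichlet-to-Neumann operator
`T φ = (i/e) ∑ φ_n β_n exp(i α_n x₁)` of the half-space of permittivity `e`, as the duality between
`H^{-1/2}` and `H^{1/2}` (the series `T φ` need not converge to a function). -/
def dtnPairing (e : ℝ) (φ ψ : ℝ → ℂ) : ℂ :=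
  P.L * ∑' n : ℤ, (I / e) * β P e n * qpCoeff P n φ * conj (qpCoeff P n ψ)

/-- The sesquilinear form `B_e` for a permittivity `e` in `Ω`. -/
def B (e : ℝ × ℝ → ℂ) (w v : H1qp P) : ℂ :=
  (∫ x in Omega P, ((1 / e x) * (w.d₁ x * conj (v.d₁ x) + w.d₂ x * conj (v.d₂ x))
      - (P.κ : ℂ) ^ 2 * (w.val x * conj (v.val x))))
    - dtnPairing P P.εm w.bot v.bot - dtnPairing P P.εp w.top v.top

/-- The functional `v ↦ -∫_Ω ∇·[(ε₊⁻¹ - e⁻¹) ∇u^inc] conj(v)`. As `e` may jump, the divergence is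
that of a distribution and the integral is understood by the divergence theorem. Since the
permittivity beyond `Γ_H`, `Γ_{-H}` is `ε₊`, `ε₋`, these are its values in the boundary terms
(so that the one on `Γ_H` is zero). -/
def source (e : ℝ × ℝ → ℂ) (v : H1qp P) : ℂ :=
  (∫ x in Omega P, (1 / (P.εp : ℂ) - 1 / e x) *
      (pd₁ (uinc P) x * conj (v.d₁ x) + pd₂ (uinc P) x * conj (v.d₂ x)))
    - (∫ x₁ in Set.Ioo 0 P.L,
        (1 / (P.εp : ℂ) - 1 / (P.εp : ℂ)) * pd₂ (uinc P) (x₁, P.H) * conj (v.top x₁))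
    + ∫ x₁ in Set.Ioo 0 P.L,
        (1 / (P.εp : ℂ) - 1 / (P.εm : ℂ)) * pd₂ (uinc P) (x₁, -P.H) * conj (v.bot x₁)

/-- `H¹(-H,H)`: square-integrable with a square-integrable weak derivative. -/
def MemH1Interval (ξ : ℝ → ℂ) : Prop :=
  MemLp ξ 2 (volume.restrict (Set.Ioo (-P.H) P.H)) ∧
  ∃ ξ' : ℝ → ℂ, MemLp ξ' 2 (volume.restrict (Set.Ioo (-P.H) P.H)) ∧
    ∀ η : ℝ → ℂ, ContDiff ℝ ∞ η → HasCompactSupport η → tsupport η ⊆ Set.Ioo (-P.H) P.H →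
      ∫ t in Set.Ioo (-P.H) P.H, ξ t * deriv η t = -∫ t in Set.Ioo (-P.H) P.H, ξ' t * η t

/-- `E_M = span {exp(i α_n x₁) : -M ≤ n ≤ M}`. -/
def E (M : ℕ) : Submodule ℂ (ℝ → ℂ) :=
  Submodule.span ℂ (mode P '' Set.Icc (-(M : ℤ)) M)

/-- `V_M = H¹(-H,H) ⊗ E_M` inside `H¹_qp(Ω)`. -/
def V (M : ℕ) : Set (H1qp P) :=
  {v | ∃ g ∈ Submodule.span ℂ {g : ℝ × ℝ → ℂ | ∃ ξ e : ℝ → ℂ, MemH1Interval P ξ ∧ e ∈ E P M ∧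
      g = fun x => ξ x.2 * e x.1}, v.val =ᵐ[volΩ P] g}

variable {P}
variable (T : Mesh P)

/-- The permittivity in slice `j`, sampled on its centre line. -/
def Mesh.sliceε (j : ℕ) (x₁ : ℝ) : ℂ := P.ε (x₁, (T.node j + T.node (j + 1)) / 2)

open Classical in
/-- The stairstep approximation `ε_h` of `ε` (the value `0` on the lines `x₂ = h_j`, a null set, is
immaterial). -/
def Mesh.εh (x : ℝ × ℝ) : ℂ :=
  ∑ j ∈ Finset.range T.S,
    if x.2 ∈ Set.Ioo (T.node j) (T.node (j + 1)) then T.sliceε j x.1 else 0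

/-- The `k`-th Fourier coefficient of the `L`-periodic function `1/ε_h` in slice `j`. -/
def Mesh.invεCoeff (j : ℕ) (k : ℤ) : ℂ :=
  (1 / (P.L : ℂ)) * ∫ x₁ in Set.Ioo 0 P.L,
    (1 / T.sliceε j x₁) * exp (-(I * (k * (2 * Real.pi / P.L) : ℝ) * x₁))

/-- The `n`-th Fourier coefficient in slice `j` of `f = ∇·[(ε₊⁻¹ - ε_h⁻¹) ∇u^inc]`. -/
def Mesh.sourceCoeff (j : ℕ) (n : ℤ) (x₂ : ℝ) : ℂ :=
  I * α P n * qpCoeff P n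
      (fun x₁ => (1 / (P.εp : ℂ) - 1 / T.sliceε j x₁) * pd₁ (uinc P) (x₁, x₂))
    + deriv (fun t : ℝ => qpCoeff P n
      (fun x₁ => (1 / (P.εp : ℂ) - 1 / T.sliceε j x₁) * pd₂ (uinc P) (x₁, t))) x₂

variable (P) in
/-- The coefficient functions of the incident field, `u^inc = ∑ u^inc_n(x₂) exp(i α_n x₁)`. -/
def incCoeff (n : ℤ) (x₂ : ℝ) : ℂ :=
  if n = 0 then exp (-(I * P.κ * (√P.εp : ℝ) * Real.cos P.θ * x₂)) else 0

/-- The coefficients of the truncated conormal derivative `ε_h⁻¹ ∂₂u^t` of the total field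
`u^t = u + u^inc` in slice `j` (one-sided derivatives at its ends). -/
def Mesh.totalFlux (M : ℕ) (u : ℤ → ℝ → ℂ) (j : ℕ) (n : ℤ) (x₂ : ℝ) : ℂ :=
  ∑ m ∈ Finset.Icc (-(M : ℤ)) M, T.invεCoeff j (n - m) *
    derivWithin (fun t => u m t + incCoeff P m t) (Set.Icc (T.node j) (T.node (j + 1))) x₂

variable (P) in
/-- The field `∑_{|n| ≤ M} u_n(x₂) exp(i α_n x₁)`. -/
def field (M : ℕ) (u : ℤ → ℝ → ℂ) (x : ℝ × ℝ) : ℂ :=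
  ∑ n ∈ Finset.Icc (-(M : ℤ)) M, u n x.2 * mode P n x.1

/-- `u_n`, `-M ≤ n ≤ M`, are the coefficient functions of the (scattered field) RCWA solution, `r`
and `t` the coefficients of the outgoing Rayleigh–Bloch expansions
`∑ r_n exp(i β_n⁺ (x₂ - H)) exp(i α_n x₁)` above `Γ_H` and
`∑ t_n exp(-i β_n⁻ (x₂ + H)) exp(i α_n x₁)` below `Γ_{-H}`. The ordinary differential equations hold
in the slices; the total field and its conormal derivative are continuous across
the lines between the slices and across `Γ_H`, `Γ_{-H}`. -/
structure Mesh.IsSolution (M : ℕ) (u : ℤ → ℝ → ℂ) (r t : ℤ → ℂ) : Prop where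
  continuousOn : ∀ n ∈ Finset.Icc (-(M : ℤ)) M, ContinuousOn (u n) (Set.Icc (-P.H) P.H)
  contDiffOn : ∀ n ∈ Finset.Icc (-(M : ℤ)) M, ∀ j < T.S,
    ContDiffOn ℝ 2 (u n) (Set.Icc (T.node j) (T.node (j + 1)))
  ode : ∀ n ∈ Finset.Icc (-(M : ℤ)) M, ∀ j < T.S,
    ∀ x₂ ∈ Set.Ioo (T.node j) (T.node (j + 1)),
      ∑ m ∈ Finset.Icc (-(M : ℤ)) M, T.invεCoeff j (n - m) * deriv (deriv (u m)) x₂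
        = α P n * ∑ m ∈ Finset.Icc (-(M : ℤ)) M, T.invεCoeff j (n - m) * (α P m * u m x₂)
          - (P.κ : ℂ) ^ 2 * u n x₂ + T.sourceCoeff j n x₂
  flux : ∀ n ∈ Finset.Icc (-(M : ℤ)) M, ∀ j, j + 1 < T.S →
    T.totalFlux M u j n (T.node (j + 1)) = T.totalFlux M u (j + 1) n (T.node (j + 1))
  top_val : ∀ n ∈ Finset.Icc (-(M : ℤ)) M,
    u n P.H + incCoeff P n P.H = incCoeff P n P.H + r n
  top_flux : ∀ n ∈ Finset.Icc (-(M : ℤ)) M,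
    T.totalFlux M u (T.S - 1) n P.H
      = (1 / (P.εp : ℂ)) * (deriv (incCoeff P n) P.H + I * β P P.εp n * r n)
  bot_val : ∀ n ∈ Finset.Icc (-(M : ℤ)) M,
    u n (-P.H) + incCoeff P n (-P.H) = incCoeff P n (-P.H) + t n
  bot_flux : ∀ n ∈ Finset.Icc (-(M : ℤ)) M,
    T.totalFlux M u 0 n (-P.H)
      = (1 / (P.εm : ℂ)) * (deriv (incCoeff P n) (-P.H) - I * β P P.εm n * t n)

end RCWA

end

/-! Inside a slice, `ode` is the n-th Fourier component of ∇·[ε_h⁻¹∇(u + u^inc) - ε₊⁻¹∇u^inc] + κ²u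
= 0. Testing with a function of `V P M` sees only the components |n| ≤ M, and for these the
truncated Toeplitz products are exact: multiplying a finite modal sum by 1/ε_h and taking its n-th
coefficient gives ∑ c_{n-m} g_m (`Mesh.qpCoeff_one_div_sliceε_mul_field`). The incident wave is
itself a single mode, so it obeys the same rule.

The central object is the scattered flux F_n = ∑ c_{n-m}(u_m + u^inc_m)' - ε₊⁻¹(u^inc_n)'. The flux
conditions make it continuous across the nodes (`Mesh.IsSolution.exists_scatteredFlux`), and the
equations take the divergence form `Mesh.IsSolution.deriv_scatteredFlux_add`. Integration by parts
in x₂ therefore leaves no interface terms, only F_n(±H) times trace coefficients of the test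
function (`Mesh.IsSolution.volume_terms`). In x₁ nothing is integrated by parts in this identity:
conjugating iα_n supplies the sign. The conditions on Γ_{±H} turn F_n(±H) into the
Dirichlet-to-Neumann terms and, at -H, the boundary part of the source.

The analytic work comes from `H1qp` and `V`. A modal sum with piecewise C¹ coefficients must be
approximated by smooth functions together with its derivatives and traces (`exists_H1qp_field`).
Membership in `V P M` speaks of `val` only, so `d₁` and `d₂` are recovered by uniqueness of weak
derivatives. The traces of a test function are never computed: their Fourier coefficients enter
through `H1qp.integral_piecewiseC1_mul_mode`, valid on all of `H1qp`. -/

noncomputable section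

namespace RCWA

/-! ### Limits of L² pairings -/

section LpSpace

variable {X : Type*} [MeasurableSpace X] {μ : Measure X}

lemma integrable_mul_of_memLp_two {f g : X → ℂ} (hf : MemLp f 2 μ) (hg : MemLp g 2 μ) :
    Integrable (fun x => f x * g x) μ :=
  hf.integrable_mul hg

lemma integrable_mul_conj_of_memLp_two {f g : X → ℂ} (hf : MemLp f 2 μ) (hg : MemLp g 2 μ) :
    Integrable (fun x => f x * conj (g x)) μ :=
  hf.integrable_mul hg.star

/-- Hölder bounds the L¹ norm of G(φ_k - f) by the product of the L² norms. This carries identities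
from the smooth approximants in `H1qp.approx` to their limit. -/
lemma tendsto_integral_mul_of_eLpNorm_two {G f : X → ℂ} {φ : ℕ → X → ℂ}
    (hG : MemLp G 2 μ) (hf : MemLp f 2 μ) (hφ : ∀ k, MemLp (φ k) 2 μ)
    (h : Tendsto (fun k => eLpNorm (φ k - f) 2 μ) atTop (𝓝 0)) :
    Tendsto (fun k => ∫ x, G x * φ k x ∂μ) atTop (𝓝 (∫ x, G x * f x ∂μ)) := by
  refine tendsto_integral_of_L1' (fun x => G x * f x) (hG.integrable_mul hf).1
    (Eventually.of_forall fun k => hG.integrable_mul (hφ k)) ?_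
  have hb : ∀ k, eLpNorm ((fun x => G x * φ k x) - fun x => G x * f x) 1 μ
      ≤ eLpNorm G 2 μ * eLpNorm (φ k - f) 2 μ := by
    intro k
    have := eLpNorm_smul_le_mul_eLpNorm (p := 2) (q := 2) (r := 1)
      ((hφ k).sub hf).1 hG.1
    refine le_trans (le_of_eq ?_) this
    congr 1
    ext x
    simp [mul_sub]
  refine tendsto_of_tendsto_of_tendsto_of_le_of_le tendsto_const_nhds ?_ (fun _ => zero_le) hb
  simpa using ENNReal.Tendsto.const_mul h (Or.inr hG.eLpNorm_ne_top)

lemma tendsto_integral_mul_conj_of_eLpNorm_two {G f : X → ℂ} {φ : ℕ → X → ℂ}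
    (hG : MemLp G 2 μ) (hf : MemLp f 2 μ) (hφ : ∀ k, MemLp (φ k) 2 μ)
    (h : Tendsto (fun k => eLpNorm (φ k - f) 2 μ) atTop (𝓝 0)) :
    Tendsto (fun k => ∫ x, G x * conj (φ k x) ∂μ) atTop (𝓝 (∫ x, G x * conj (f x) ∂μ)) := by
  refine tendsto_integral_mul_of_eLpNorm_two hG hf.star (fun k => (hφ k).star) ?_
  convert h using 2 with k
  refine eLpNorm_congr_norm_ae (Eventually.of_forall fun x => ?_)
  simp only [Pi.sub_apply, ← map_sub, RCLike.norm_conj]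

end LpSpace

/-! ### Piecewise C¹ functions on the mesh and their smooth approximation -/

/-- Smooth functions are dense in `L²` of a bounded interval. -/
lemma exists_contDiff_eLpNorm_sub_le {a b : ℝ} {p : ℝ → ℂ}
    (hp : MemLp p 2 (volume.restrict (Set.Ioo a b))) {δ : ENNReal} (hδ : δ ≠ 0) :
    ∃ q : ℝ → ℂ, ContDiff ℝ ∞ q ∧ eLpNorm (q - p) 2 (volume.restrict (Set.Ioo a b)) ≤ δ := by
  set ν := volume.restrict (Set.Ioo a b)
  obtain ⟨g, hgs, hgp, hgc, hgm⟩ := hp.exists_hasCompactSupport_eLpNorm_sub_le (by simp)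
    (ENNReal.half_pos hδ).ne'
  have htop : ν Set.univ ^ (1 / 2 : ℝ) ≠ ⊤ := by
    refine ENNReal.rpow_ne_top_of_nonneg (by norm_num) (measure_ne_top _ _)
  -- A uniform error c costs at most |(a,b)|^{1/2} c in L²; c is chosen so that smoothing the
  -- continuous approximant g uses the second half of δ.
  obtain ⟨c, hc, hcδ⟩ : ∃ c : ℝ, 0 < c ∧
      ν Set.univ ^ (1 / 2 : ℝ) * ENNReal.ofReal c ≤ δ / 2 := by
    have : Tendsto (fun c : ℝ => ν Set.univ ^ (1 / 2 : ℝ) * ENNReal.ofReal c) (𝓝[>] 0) (𝓝 0) := by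
      have h0 : Tendsto (fun c : ℝ => ENNReal.ofReal c) (𝓝[>] 0) (𝓝 0) := by
        simpa using (ENNReal.continuous_ofReal.tendsto 0).mono_left nhdsWithin_le_nhds
      simpa using ENNReal.Tendsto.const_mul h0 (Or.inr htop)
    have h1 := this.eventually (ge_mem_nhds (ENNReal.half_pos hδ))
    obtain ⟨c, h, hc⟩ := (h1.and self_mem_nhdsWithin).exists
    exact ⟨c, hc, h⟩
  obtain ⟨q, hq, hqg⟩ := (hgs.uniformContinuous_of_continuous hgc).exists_contDiff_dist_le hc
  refine ⟨q, hq, ?_⟩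
  have h2 : eLpNorm (q - g) 2 ν ≤ δ / 2 := by
    refine le_trans (eLpNorm_le_of_ae_bound (C := c) (Eventually.of_forall fun x => ?_)) ?_
    · rw [Pi.sub_apply, ← dist_eq_norm]; exact (hqg x).le
    · simpa using hcδ
  have h3 : eLpNorm (g - p) 2 ν ≤ δ / 2 := by rwa [eLpNorm_sub_comm]
  calc eLpNorm (q - p) 2 ν = eLpNorm ((q - g) + (g - p)) 2 ν := by simp
    _ ≤ eLpNorm (q - g) 2 ν + eLpNorm (g - p) 2 ν :=
      eLpNorm_add_le (hq.continuous.sub hgc).aestronglyMeasurable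
        (hgc.aestronglyMeasurable.sub hp.1) (by norm_num)
    _ ≤ δ / 2 + δ / 2 := add_le_add h2 h3
    _ = δ := ENNReal.add_halves δ

/-- Continuous on `[-H,H]` and continuously differentiable on each closed slice. -/
def Mesh.PiecewiseC1 {P : Grating} (T : Mesh P) (F : ℝ → ℂ) : Prop :=
  ContinuousOn F (Set.Icc (-P.H) P.H) ∧
    ∀ j < T.S, ContDiffOn ℝ 1 F (Set.Icc (T.node j) (T.node (j + 1)))

/-- The finite set of nodes. -/
def Mesh.nodes {P : Grating} (T : Mesh P) : Set ℝ := T.node '' Set.Iic T.S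

variable {P : Grating} {T : Mesh P}

lemma Mesh.countable_nodes : T.nodes.Countable := ((Set.finite_Iic T.S).image _).countable

lemma Mesh.node_mono {j k : ℕ} (hjk : j ≤ k) (hk : k ≤ T.S) : T.node j ≤ T.node k := by
  induction k, hjk using Nat.le_induction with
  | base => exact le_rfl
  | succ k hjk ih => exact (ih (by omega)).trans (T.node_lt k (by omega)).le

lemma Mesh.neg_H_le_node {j : ℕ} (hj : j ≤ T.S) : -P.H ≤ T.node j := by
  rw [← T.node_zero]; exact T.node_mono (Nat.zero_le j) hj

lemma Mesh.node_le_H {j : ℕ} (hj : j ≤ T.S) : T.node j ≤ P.H := by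
  rw [← T.node_last]; exact T.node_mono hj le_rfl

/-- The first node to the right of x closes the slice containing x; it is not node 0 because x > -H,
and its predecessor lies strictly to the left because x is not a node. -/
lemma Mesh.exists_slice {x : ℝ} (hx : x ∈ Set.Ioo (-P.H) P.H \ T.nodes) :
    ∃ j < T.S, x ∈ Set.Ioo (T.node j) (T.node (j + 1)) := by
  classical
  have hex : ∃ k, k ≤ T.S ∧ x < T.node k := ⟨T.S, le_rfl, by rw [T.node_last]; exact hx.1.2⟩
  obtain ⟨hk, hxk⟩ := Nat.find_spec hex
  have hmin := fun m => Nat.find_min hex (m := m)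
  generalize Nat.find hex = k at *
  obtain _ | j := k
  · rw [T.node_zero] at hxk
    exact absurd hx.1.1 hxk.le.not_gt
  · refine ⟨j, hk, lt_of_le_of_ne ?_ ?_, hxk⟩
    · by_contra! h
      exact hmin j (Nat.lt_succ_self j) ⟨by omega, h⟩
    · intro h
      exact hx.2 ⟨j, by simp; omega, h⟩

lemma Mesh.Ioo_subset {j : ℕ} (hj : j < T.S) :
    Set.Ioo (T.node j) (T.node (j + 1)) ⊆ Set.Ioo (-P.H) P.H :=
  Set.Ioo_subset_Ioo (T.neg_H_le_node hj.le) (T.node_le_H hj)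

lemma Mesh.not_mem_slice {i j : ℕ} (hij : i ≠ j) (hi : i < T.S) (hj : j < T.S) {x : ℝ}
    (hx : x ∈ Set.Ioo (T.node j) (T.node (j + 1))) :
    x ∉ Set.Ioo (T.node i) (T.node (i + 1)) := by
  intro hx'
  rcases lt_or_gt_of_ne hij with h | h
  · exact absurd (hx.1.trans hx'.2) (T.node_mono (show i + 1 ≤ j from h) hj.le).not_gt
  · exact absurd (hx'.1.trans hx.2) (T.node_mono (show j + 1 ≤ i from h) hi.le).not_gt

lemma Mesh.ae_mem_slice : ∀ᵐ x ∂(volume.restrict (Set.Ioo (-P.H) P.H)),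
    ∃ j < T.S, x ∈ Set.Ioo (T.node j) (T.node (j + 1)) := by
  have h1 : ∀ᵐ x ∂(volume.restrict (Set.Ioo (-P.H) P.H)), x ∉ T.nodes :=
    ae_restrict_of_ae (T.countable_nodes.ae_notMem _)
  filter_upwards [h1, ae_restrict_mem measurableSet_Ioo] with x h h'
  exact T.exists_slice ⟨h', h⟩

/-- The one-sided derivative is continuous on the compact interval, hence bounded, and it is the
ordinary derivative in the interior. -/
lemma _root_.ContDiffOn.differentiableAt_and_exists_norm_deriv_le {F : ℝ → ℂ} {a b : ℝ}
    (hab : a < b) (hF : ContDiffOn ℝ 1 F (Set.Icc a b)) :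
    ∃ C, 0 ≤ C ∧ ∀ x ∈ Set.Ioo a b, DifferentiableAt ℝ F x ∧ ‖deriv F x‖ ≤ C := by
  have hc := hF.continuousOn_derivWithin (uniqueDiffOn_Icc hab) le_rfl
  obtain ⟨C, hC⟩ := isCompact_Icc.exists_bound_of_continuousOn hc
  refine ⟨C, (norm_nonneg _).trans (hC a (Set.left_mem_Icc.2 hab.le)), fun x hx => ?_⟩
  have hn := Icc_mem_nhds hx.1 hx.2
  refine ⟨(hF.differentiableOn (by norm_num)).differentiableAt hn, ?_⟩
  rw [← derivWithin_of_mem_nhds hn]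
  exact hC x (Set.Ioo_subset_Icc_self hx)

namespace Mesh.PiecewiseC1

variable {F : ℝ → ℂ} (hF : T.PiecewiseC1 F)
include hF

lemma exists_bound : ∃ C, ∀ x ∈ Set.Ioo (-P.H) P.H \ T.nodes,
    DifferentiableAt ℝ F x ∧ ‖deriv F x‖ ≤ C := by
  have h : ∀ j, ∃ C, 0 ≤ C ∧ (j < T.S → ∀ x ∈ Set.Ioo (T.node j) (T.node (j + 1)),
      DifferentiableAt ℝ F x ∧ ‖deriv F x‖ ≤ C) := by
    intro j
    by_cases hj : j < T.S
    · obtain ⟨C, h0, hC⟩ :=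
        (hF.2 j hj).differentiableAt_and_exists_norm_deriv_le (T.node_lt j hj)
      exact ⟨C, h0, fun _ => hC⟩
    · exact ⟨0, le_rfl, fun h => absurd h hj⟩
  choose C h0 hC using h
  -- The bounds are nonnegative, so their sum over the slices dominates each of them.
  refine ⟨∑ j ∈ Finset.range T.S, C j, fun x hx => ?_⟩
  obtain ⟨j, hj, hxj⟩ := T.exists_slice hx
  refine ⟨(hC j hj x hxj).1, (hC j hj x hxj).2.trans ?_⟩
  exact Finset.single_le_sum (fun i _ => h0 i) (Finset.mem_range.2 hj)

lemma hasDerivAt {x : ℝ} (hx : x ∈ Set.Ioo (-P.H) P.H \ T.nodes) :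
    HasDerivAt F (deriv F x) x := by
  obtain ⟨C, hC⟩ := hF.exists_bound
  exact (hC x hx).1.hasDerivAt

lemma memLp : MemLp F 2 (volume.restrict (Set.Ioo (-P.H) P.H)) := by
  obtain ⟨C, hC⟩ := isCompact_Icc.exists_bound_of_continuousOn hF.1
  refine MemLp.of_bound ((hF.1.mono Set.Ioo_subset_Icc_self).aestronglyMeasurable
    measurableSet_Ioo) C ?_
  filter_upwards [ae_restrict_mem measurableSet_Ioo] with x hx
  exact hC x (Set.Ioo_subset_Icc_self hx)

lemma memLp_deriv : MemLp (deriv F) 2 (volume.restrict (Set.Ioo (-P.H) P.H)) := by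
  obtain ⟨C, hC⟩ := hF.exists_bound
  refine MemLp.of_bound (measurable_deriv F).aestronglyMeasurable C ?_
  have h1 : ∀ᵐ x ∂(volume.restrict (Set.Ioo (-P.H) P.H)), x ∉ T.nodes :=
    ae_restrict_of_ae (T.countable_nodes.ae_notMem _)
  filter_upwards [h1, ae_restrict_mem measurableSet_Ioo] with x h h'
  exact (hC x ⟨h', h⟩).2

/-- The fundamental theorem of calculus allows countably many exceptional points as long as the
product is continuous; the continuity of F is what removes jump terms at the nodes. -/
lemma integral_deriv_mul_add {a : ℝ → ℂ} (ha : ContDiff ℝ 1 a) :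
    ∫ x in Set.Ioo (-P.H) P.H, (deriv F x * a x + F x * deriv a x)
      = F P.H * a P.H - F (-P.H) * a (-P.H) := by
  have hH : -P.H ≤ P.H := by linarith [P.H_pos]
  have hca : ∀ {g : ℝ → ℂ}, Continuous g → MemLp g 2 (volume.restrict (Set.Ioo (-P.H) P.H)) := by
    intro g hg
    obtain ⟨C, hC⟩ := (isCompact_Icc (a := -P.H) (b := P.H)).exists_bound_of_continuousOn
      hg.continuousOn
    refine MemLp.of_bound hg.aestronglyMeasurable C ?_
    filter_upwards [ae_restrict_mem measurableSet_Ioo] with x hx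
    exact hC x (Set.Ioo_subset_Icc_self hx)
  have hint : IntegrableOn (fun x => deriv F x * a x + F x * deriv a x)
      (Set.Ioo (-P.H) P.H) volume :=
    (hF.memLp_deriv.integrable_mul (hca ha.continuous)).add
      (hF.memLp.integrable_mul (hca (ha.continuous_deriv le_rfl)))
  rw [← integral_Ioc_eq_integral_Ioo, ← intervalIntegral.integral_of_le hH]
  refine integral_eq_of_hasDerivAt_off_countable_of_le (fun x => F x * a x) _ hH
    T.countable_nodes (hF.1.mul ha.continuous.continuousOn) (fun x hx => ?_) ?_
  · exact (hF.hasDerivAt hx).mul (ha.differentiable (by norm_num) x).hasDerivAt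
  · rw [intervalIntegrable_iff_integrableOn_Ioo_of_le hH]
    exact hint

lemma memH1Interval : MemH1Interval P F := by
  refine ⟨hF.memLp, deriv F, hF.memLp_deriv, fun η hη hηc hηs => ?_⟩
  have h := hF.integral_deriv_mul_add (hη.of_le (by exact_mod_cast le_top))
  have hz : ∀ y, y ∉ Set.Ioo (-P.H) P.H → η y = 0 := fun y hy =>
    image_eq_zero_of_notMem_tsupport fun h => hy (hηs h)
  rw [hz P.H (by simp), hz (-P.H) (by simp), integral_add] at h
  · rw [mul_zero, mul_zero, sub_zero] at h
    exact eq_neg_of_add_eq_zero_right h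
  · exact hF.memLp_deriv.integrable_mul (q := 2) (hη.continuous.memLp_of_hasCompactSupport hηc)
  · exact hF.memLp.integrable_mul (q := 2) ((hη.continuous_deriv (by simp)).memLp_of_hasCompactSupport
      hηc.deriv)

lemma eq_add_integral {x : ℝ} (hx : x ∈ Set.Icc (-P.H) P.H) :
    F x = F (-P.H) + ∫ s in (-P.H)..x, deriv F s := by
  have := integral_eq_of_hasDerivAt_off_countable_of_le F (deriv F) hx.1 T.countable_nodes
    (hF.1.mono (Set.Icc_subset_Icc_right hx.2))
    (fun y hy => hF.hasDerivAt ⟨⟨hy.1.1, hy.1.2.trans_le hx.2⟩, hy.2⟩) (by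
      rw [intervalIntegrable_iff_integrableOn_Ioo_of_le hx.1]
      exact IntegrableOn.mono_set (hF.memLp_deriv.integrable (by norm_num))
        (Set.Ioo_subset_Ioo_right hx.2))
  rw [this]; ring

/-- A piecewise `C¹` function is the limit of smooth functions in `H¹(-H,H)` and uniformly. -/
lemma exists_contDiff_approx {δ : ENNReal} (hδ : δ ≠ 0) :
    ∃ w : ℝ → ℂ, ContDiff ℝ ∞ w ∧
      eLpNorm (deriv w - deriv F) 2 (volume.restrict (Set.Ioo (-P.H) P.H)) ≤ δ ∧
      ∀ x ∈ Set.Icc (-P.H) P.H, ‖w x - F x‖ₑ ≤ δ := by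
  set ν := volume.restrict (Set.Ioo (-P.H) P.H) with hν
  set A : ENNReal := ν Set.univ ^ (1 / 2 : ℝ) with hA
  have hAtop : A ≠ ⊤ := ENNReal.rpow_ne_top_of_nonneg (by norm_num) (measure_ne_top _ _)
  -- The bound δ controls the derivative in L²; δ / A controls the function uniformly, since the L¹
  -- norm on (-H,H) is at most A times the L² norm.
  have hδ' : min δ (δ / A) ≠ 0 :=
    (lt_min (pos_iff_ne_zero.2 hδ) (ENNReal.div_pos hδ hAtop)).ne'
  obtain ⟨q, hq, hqF⟩ := exists_contDiff_eLpNorm_sub_le hF.memLp_deriv hδ'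
  -- The primitive of q with the initial value of F, so that w - F is the integral of q - F'.
  set w : ℝ → ℂ := fun x => F (-P.H) + ∫ s in (-P.H)..x, q s
  have hw : ∀ x, HasDerivAt w (q x) x := fun x =>
    (intervalIntegral.integral_hasDerivAt_right (hq.continuous.intervalIntegrable _ _)
      hq.continuous.aestronglyMeasurable.stronglyMeasurableAtFilter
      hq.continuous.continuousAt).const_add _
  have hdw : deriv w = q := funext fun x => (hw x).deriv
  refine ⟨w, ?_, ?_, fun x hx => ?_⟩
  · rw [contDiff_infty_iff_deriv, hdw]
    exact ⟨fun x => (hw x).differentiableAt, hq⟩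
  · rw [hdw]; exact hqF.trans (min_le_left _ _)
  · have hqi : IntegrableOn q (Set.Ioo (-P.H) P.H) :=
      (hq.continuous.integrableOn_Icc).mono_set Set.Ioo_subset_Icc_self
    have hFi : IntegrableOn (deriv F) (Set.Ioo (-P.H) P.H) :=
      hF.memLp_deriv.integrable (by norm_num)
    have hsub : Set.Ioo (-P.H) x ⊆ Set.Ioo (-P.H) P.H := Set.Ioo_subset_Ioo_right hx.2
    have h1 : w x - F x = ∫ s in Set.Ioo (-P.H) x, (q - deriv F) s := by
      rw [hF.eq_add_integral hx, add_sub_add_left_eq_sub, ← intervalIntegral.integral_sub,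
        intervalIntegral.integral_of_le hx.1, integral_Ioc_eq_integral_Ioo]
      · rfl
      · exact hq.continuous.intervalIntegrable _ _
      · rw [intervalIntegrable_iff_integrableOn_Ioo_of_le hx.1]
        exact hFi.mono_set hsub
    rw [h1]
    calc ‖∫ s in Set.Ioo (-P.H) x, (q - deriv F) s‖ₑ
        ≤ ∫⁻ s in Set.Ioo (-P.H) x, ‖(q - deriv F) s‖ₑ := enorm_integral_le_lintegral_enorm _
      _ ≤ ∫⁻ s in Set.Ioo (-P.H) P.H, ‖(q - deriv F) s‖ₑ := lintegral_mono_set hsub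
      _ = eLpNorm (q - deriv F) 1 ν := (eLpNorm_one_eq_lintegral_enorm).symm
      _ ≤ eLpNorm (q - deriv F) 2 ν * A := by
        have := eLpNorm_le_eLpNorm_mul_rpow_measure_univ (μ := ν) (p := 1) (q := 2)
          (f := q - deriv F) (by norm_num) (hqi.1.sub hFi.1)
        refine this.trans (le_of_eq ?_)
        rw [hA]; norm_num
      _ ≤ δ / A * A := by gcongr; exact hqF.trans (min_le_right _ _)
      _ ≤ δ := ENNReal.mul_le_of_le_div le_rfl

end Mesh.PiecewiseC1

/-- Functions on the closed slices that agree at the inner nodes have a common extension. -/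
lemma Mesh.exists_glue (f : ℕ → ℝ → ℂ)
    (hf : ∀ j < T.S, ContDiffOn ℝ 1 (f j) (Set.Icc (T.node j) (T.node (j + 1))))
    (hm : ∀ j, j + 1 < T.S → f j (T.node (j + 1)) = f (j + 1) (T.node (j + 1))) :
    ∃ F, T.PiecewiseC1 F ∧ ∀ j < T.S, Set.EqOn F (f j) (Set.Icc (T.node j) (T.node (j + 1))) := by
  -- Induction on the number of slices covered: only continuity has to be glued, while C¹ regularity
  -- is inherited from each f j.
  suffices h : ∀ k, k < T.S → ∃ F, ContinuousOn F (Set.Icc (T.node 0) (T.node (k + 1))) ∧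
      ∀ j ≤ k, Set.EqOn F (f j) (Set.Icc (T.node j) (T.node (j + 1))) by
    obtain ⟨F, hFc, hF⟩ := h (T.S - 1) (by have := T.S_pos; omega)
    rw [Nat.sub_add_cancel T.S_pos, T.node_zero, T.node_last] at hFc
    exact ⟨F, ⟨hFc, fun j hj => (hf j hj).congr (hF j (by omega))⟩, fun j hj => hF j (by omega)⟩
  intro k
  induction k with
  | zero =>
    intro hk
    refine ⟨f 0, (hf 0 hk).continuousOn, fun j hj => ?_⟩
    obtain rfl : j = 0 := by omega
    exact fun _ _ => rfl
  | succ k ih =>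
    intro hk
    obtain ⟨F, hFc, hF⟩ := ih (by omega)
    set c := T.node (k + 1) with hc
    have hkc : T.node k ≤ c := (T.node_lt k (by omega)).le
    have hFk : F c = f (k + 1) c := by
      rw [hF k le_rfl (Set.right_mem_Icc.2 hkc), hm k hk]
    have h0c : T.node 0 ≤ c := T.node_mono (Nat.zero_le _) hk.le
    have hc2 : c ≤ T.node (k + 1 + 1) := (T.node_lt (k + 1) hk).le
    set G : ℝ → ℂ := fun x => if x ≤ c then F x else f (k + 1) x with hG
    have hG1 : ∀ x, x ≤ c → G x = F x := fun x hx => if_pos hx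
    have hG2 : ∀ x, c ≤ x → G x = f (k + 1) x := by
      intro x hx
      rcases hx.eq_or_lt with rfl | h
      · rw [hG1 c le_rfl, hFk]
      · exact if_neg h.not_ge
    refine ⟨G, ?_, fun j hj x hx => ?_⟩
    · rw [← Set.Icc_union_Icc_eq_Icc h0c hc2]
      refine ContinuousOn.union_of_isClosed ?_ ?_ isClosed_Icc isClosed_Icc
      · exact hFc.congr fun x hx => hG1 x hx.2
      · exact (hf (k + 1) hk).continuousOn.congr fun x hx => hG2 x hx.1
    · rcases Nat.lt_or_ge k j with h | h
      · obtain rfl : j = k + 1 := by omega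
        exact hG2 x hx.1
      · rw [hG1 x (hx.2.trans (T.node_mono (by omega) hk.le))]
        exact hF j h hx

/-! ### Quasi-periodic modes and their orthogonality -/

section Modes

variable (P : Grating)

/-- Lebesgue measure on `(-H,H)`. -/
abbrev volI : Measure ℝ := volume.restrict (Set.Ioo (-P.H) P.H)

lemma volΩ_eq_prod : volΩ P = (volΓ P).prod (volI P) := by
  rw [volΩ, volΓ, volI, Measure.prod_restrict]; rfl

instance : IsFiniteMeasure (volΓ P) := by unfold volΓ; infer_instance

instance : IsFiniteMeasure (volΩ P) := by rw [volΩ_eq_prod]; infer_instance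

lemma norm_mode (n : ℤ) (x : ℝ) : ‖mode P n x‖ = 1 := by
  rw [mode, show I * (α P n : ℂ) * x = ((α P n * x : ℝ) : ℂ) * I by push_cast; ring]
  exact norm_exp_ofReal_mul_I _

lemma hasDerivAt_mode (n : ℤ) (x : ℝ) :
    HasDerivAt (mode P n) (I * α P n * mode P n x) x := by
  have h : HasDerivAt (fun y : ℝ => I * (α P n : ℂ) * y) (I * α P n) x := by
    simpa using (hasDerivAt_id x).ofReal_comp.const_mul (I * (α P n : ℂ))
  rw [mul_comm]
  exact h.cexp

lemma contDiff_mode (n : ℤ) : ContDiff ℝ ∞ (mode P n) := by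
  have h : ContDiff ℝ ∞ (fun y : ℝ => (y : ℂ)) := ofRealCLM.contDiff
  exact (contDiff_const.mul h).cexp

lemma continuous_mode (n : ℤ) : Continuous (mode P n) := (contDiff_mode P n).continuous

lemma conj_mode (n : ℤ) (x : ℝ) : conj (mode P n x) = exp (-(I * α P n * x)) := by
  rw [mode, ← exp_conj]; simp

/-- The common shift α_0 cancels, leaving an L-periodic exponential that depends on n - m only: the
source of the Toeplitz structure c_{n-m}. -/
lemma mode_mul_conj_mode (m n : ℤ) (x : ℝ) : mode P m x * conj (mode P n x)
    = exp (-(I * (((n - m : ℤ) : ℝ) * (2 * Real.pi / P.L) : ℝ) * x)) := by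
  rw [conj_mode, mode, ← exp_add]
  congr 1
  simp only [α]
  push_cast
  ring

lemma mode_add_period (n : ℤ) (x : ℝ) :
    mode P n (x + P.L) = exp (I * α P 0 * P.L) * mode P n x := by
  have hL : (P.L : ℂ) ≠ 0 := by exact_mod_cast P.L_pos.ne'
  have h : I * α P n * ((x + P.L : ℝ) : ℂ)
      = I * α P 0 * P.L + I * α P n * x + n * (2 * Real.pi * I) := by
    simp only [α]; push_cast; field_simp; ring
  rw [mode, h, exp_add, exp_int_mul_two_pi_mul_I, mul_one, exp_add, mode]

lemma memLp_mode (n : ℤ) : MemLp (mode P n) 2 (volΓ P) :=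
  MemLp.of_bound (continuous_mode P n).aestronglyMeasurable 1
    (Eventually.of_forall fun x => (norm_mode P n x).le)

lemma L_mul_qpCoeff (n : ℤ) (φ : ℝ → ℂ) :
    P.L * qpCoeff P n φ = ∫ x, φ x * conj (mode P n x) ∂(volΓ P) := by
  have hL : (P.L : ℂ) ≠ 0 := by exact_mod_cast P.L_pos.ne'
  simp only [qpCoeff, conj_mode, volΓ]
  field_simp

lemma qpCoeff_mode (m n : ℤ) : qpCoeff P n (mode P m) = if m = n then 1 else 0 := by
  have hL : (P.L : ℂ) ≠ 0 := by exact_mod_cast P.L_pos.ne'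
  apply mul_left_cancel₀ hL
  rw [L_mul_qpCoeff]
  split_ifs with h
  · subst h
    have : ∀ x, mode P m x * conj (mode P m x) = 1 := by
      intro x; rw [mul_conj, normSq_eq_norm_sq, norm_mode]; simp
    simp [this, volΓ, P.L_pos.le, measureReal_def]
  · set k : ℂ := -(I * (((n - m : ℤ) : ℝ) * (2 * Real.pi / P.L) : ℝ)) with hk
    have hnm : ((n : ℂ) - m) ≠ 0 := by
      rw [sub_ne_zero]; exact_mod_cast Ne.symm h
    have hk0 : k ≠ 0 := by
      rw [hk]
      push_cast
      simp [hnm, hL, Real.pi_ne_zero]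
    have h1 : ∀ x : ℝ, mode P m x * conj (mode P n x) = exp (k * x) := by
      intro x; rw [mode_mul_conj_mode, hk, neg_mul]
    simp only [h1, volΓ, mul_zero]
    rw [← integral_Ioc_eq_integral_Ioo, ← intervalIntegral.integral_of_le P.L_pos.le,
      integral_exp_mul_complex hk0]
    have h2 : k * P.L = ((m - n : ℤ) : ℂ) * (2 * Real.pi * I) := by
      rw [hk]; push_cast; field_simp; ring
    rw [h2, exp_int_mul_two_pi_mul_I]
    simp

end Modes

/-! ### Finite modal expansions as elements of H¹_qp -/

section Fields

variable {P : Grating} {M : ℕ}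

lemma continuous_memLp_volΩ {f : ℝ × ℝ → ℂ} (hf : Continuous f) : MemLp f 2 (volΩ P) := by
  obtain ⟨C, hC⟩ := ((isCompact_Icc (a := (0 : ℝ)) (b := P.L)).prod
    (isCompact_Icc (a := -P.H) (b := P.H))).exists_bound_of_continuousOn hf.continuousOn
  refine MemLp.of_bound hf.aestronglyMeasurable C ?_
  filter_upwards [ae_restrict_mem (measurableSet_Ioo.prod measurableSet_Ioo)] with x hx
  exact hC x ⟨Set.Ioo_subset_Icc_self hx.1, Set.Ioo_subset_Icc_self hx.2⟩

lemma continuous_memLp_volΓ {f : ℝ → ℂ} (hf : Continuous f) : MemLp f 2 (volΓ P) := by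
  obtain ⟨C, hC⟩ := (isCompact_Icc (a := (0 : ℝ)) (b := P.L)).exists_bound_of_continuousOn
    hf.continuousOn
  refine MemLp.of_bound hf.aestronglyMeasurable C ?_
  filter_upwards [ae_restrict_mem measurableSet_Ioo] with x hx
  exact hC x (Set.Ioo_subset_Icc_self hx)

/-- Modes have modulus one, and projecting Ω to x₂ pushes Lebesgue measure to the length of Γ times
Lebesgue measure on (-H,H). -/
lemma eLpNorm_mul_mode {f : ℝ → ℂ} (hf : AEStronglyMeasurable f (volI P)) (n : ℤ) :
    eLpNorm (fun x : ℝ × ℝ => f x.2 * mode P n x.1) 2 (volΩ P)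
      = volΓ P Set.univ ^ (1 / 2 : ℝ) * eLpNorm f 2 (volI P) := by
  have h1 : eLpNorm (fun x : ℝ × ℝ => f x.2 * mode P n x.1) 2 (volΩ P)
      = eLpNorm (f ∘ Prod.snd) 2 ((volΓ P).prod (volI P)) := by
    rw [← volΩ_eq_prod]
    exact eLpNorm_congr_norm_ae (Eventually.of_forall fun x => by simp [norm_mode])
  have hmap : ((volΓ P).prod (volI P)).map Prod.snd = volΓ P Set.univ • volI P :=
    Measure.map_snd_prod
  rw [h1, ← eLpNorm_map_measure (by rw [hmap]; exact hf.smul_measure _) measurable_snd.aemeasurable,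
    hmap, eLpNorm_smul_measure_of_ne_top (by norm_num)]
  simp

lemma aestronglyMeasurable_mul_mode {f : ℝ → ℂ} (hf : AEStronglyMeasurable f (volI P)) (n : ℤ) :
    AEStronglyMeasurable (fun x : ℝ × ℝ => f x.2 * mode P n x.1) (volΩ P) := by
  rw [volΩ_eq_prod]
  exact hf.comp_snd.mul ((continuous_mode P n).comp continuous_fst).aestronglyMeasurable

lemma memLp_mul_mode {f : ℝ → ℂ} (hf : MemLp f 2 (volI P)) (n : ℤ) :
    MemLp (fun x : ℝ × ℝ => f x.2 * mode P n x.1) 2 (volΩ P) := by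
  refine ⟨aestronglyMeasurable_mul_mode hf.1 n, ?_⟩
  rw [eLpNorm_mul_mode hf.1]
  exact ENNReal.mul_lt_top (ENNReal.rpow_lt_top_of_nonneg (by norm_num) (measure_ne_top _ _)) hf.2

lemma memLp_field {g : ℤ → ℝ → ℂ} (hg : ∀ n ∈ Finset.Icc (-(M : ℤ)) M, MemLp (g n) 2 (volI P)) :
    MemLp (field P M g) 2 (volΩ P) :=
  memLp_finsetSum _ fun n hn => memLp_mul_mode (hg n hn) n

lemma field_sub (g h : ℤ → ℝ → ℂ) : field P M g - field P M h = field P M (g - h) := by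
  ext x
  simp [field, sub_mul]

lemma eLpNorm_field_le {g : ℤ → ℝ → ℂ}
    (hg : ∀ n ∈ Finset.Icc (-(M : ℤ)) M, AEStronglyMeasurable (g n) (volI P)) :
    eLpNorm (field P M g) 2 (volΩ P) ≤
      ∑ n ∈ Finset.Icc (-(M : ℤ)) M, volΓ P Set.univ ^ (1 / 2 : ℝ) * eLpNorm (g n) 2 (volI P) := by
  have h : field P M g = ∑ n ∈ Finset.Icc (-(M : ℤ)) M,
      fun x : ℝ × ℝ => g n x.2 * mode P n x.1 := by
    ext x; simp [field]
  rw [h]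
  refine (eLpNorm_sum_le (fun n hn => aestronglyMeasurable_mul_mode (hg n hn) n)
    (by norm_num)).trans (Finset.sum_le_sum fun n hn => ?_)
  rw [eLpNorm_mul_mode (hg n hn)]

lemma enorm_field_le (g : ℤ → ℝ → ℂ) (x : ℝ × ℝ) :
    ‖field P M g x‖ₑ ≤ ∑ n ∈ Finset.Icc (-(M : ℤ)) M, ‖g n x.2‖ₑ := by
  refine (enorm_sum_le _ _).trans (Finset.sum_le_sum fun n _ => ?_)
  rw [enorm_mul, ← ofReal_norm (mode P n x.1), norm_mode]
  simp

lemma pd₁_field (g : ℤ → ℝ → ℂ) :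
    pd₁ (field P M g) = field P M (fun n x₂ => I * α P n * g n x₂) := by
  ext x
  refine HasDerivAt.deriv ?_
  refine HasDerivAt.fun_sum fun n _ => ?_
  exact ((hasDerivAt_mode P n x.1).const_mul (g n x.2)).congr_deriv (by ring)

lemma pd₂_field {g : ℤ → ℝ → ℂ} (hg : ∀ n, Differentiable ℝ (g n)) :
    pd₂ (field P M g) = field P M (fun n => deriv (g n)) := by
  ext x
  refine HasDerivAt.deriv ?_
  exact HasDerivAt.fun_sum fun n _ => (hg n x.2).hasDerivAt.mul_const (mode P n x.1)

lemma isSmoothQP_field {g : ℤ → ℝ → ℂ} (hg : ∀ n, ContDiff ℝ ∞ (g n)) :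
    IsSmoothQP P (field P M g) := by
  refine ⟨ContDiff.sum fun n _ => ((hg n).comp contDiff_snd).mul
    ((contDiff_mode P n).comp contDiff_fst), fun x₁ x₂ => ?_⟩
  simp only [field, mode_add_period, Finset.mul_sum]
  exact Finset.sum_congr rfl fun n _ => by ring

lemma tendsto_zero_of_le_mul_inv {f : ℕ → ENNReal} {C : ENNReal} (hC : C ≠ ⊤)
    (h : ∀ k, f k ≤ C * (k : ENNReal)⁻¹) : Tendsto f atTop (𝓝 0) := by
  refine tendsto_of_tendsto_of_tendsto_of_le_of_le tendsto_const_nhds ?_ (fun _ => zero_le) h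
  simpa using ENNReal.Tendsto.const_mul ENNReal.tendsto_inv_nat_nhds_zero (Or.inr hC)

lemma eLpNorm_two_le_of_enorm_le {X : Type*} [MeasurableSpace X] {μ : Measure X}
    {f : X → ℂ} {C : ENNReal} (h : ∀ᵐ x ∂μ, ‖f x‖ₑ ≤ C) :
    eLpNorm f 2 μ ≤ μ Set.univ ^ (1 / 2 : ℝ) * C := by
  refine (eLpNorm_mono_enorm_ae (g := fun _ => C) (by simpa using h)).trans ?_
  by_cases hμ : μ = 0
  · simp [hμ]
  · rw [eLpNorm_const _ (by norm_num) hμ]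
    simp [mul_comm]

/-- A finite modal expansion with piecewise `C¹` coefficients is an element of `H¹_qp`. -/
theorem exists_H1qp_field {T : Mesh P} {u : ℤ → ℝ → ℂ}
    (hu : ∀ n ∈ Finset.Icc (-(M : ℤ)) M, T.PiecewiseC1 (u n)) :
    ∃ U : H1qp P, U.val = field P M u ∧
      U.d₁ = field P M (fun n x₂ => I * α P n * u n x₂) ∧
      U.d₂ = field P M (fun n => deriv (u n)) ∧
      U.top = (fun x₁ => field P M u (x₁, P.H)) ∧
      U.bot = (fun x₁ => field P M u (x₁, -P.H)) := by
  -- The tolerance k⁻¹ is infinite at k = 0, which is harmless. Outside |n| ≤ M the approximant is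
  -- 0, as the smoothness lemmas for `field` ask for all n.
  have hw : ∀ (k : ℕ) (n : ℤ), ∃ w : ℝ → ℂ, ContDiff ℝ ∞ w ∧
      (n ∈ Finset.Icc (-(M : ℤ)) M →
        eLpNorm (deriv w - deriv (u n)) 2 (volI P) ≤ (k : ENNReal)⁻¹ ∧
        ∀ x ∈ Set.Icc (-P.H) P.H, ‖w x - u n x‖ₑ ≤ (k : ENNReal)⁻¹) := by
    intro k n
    by_cases hn : n ∈ Finset.Icc (-(M : ℤ)) M
    · obtain ⟨w, h1, h2⟩ := (hu n hn).exists_contDiff_approx (δ := (k : ENNReal)⁻¹) (by simp)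
      exact ⟨w, h1, fun _ => h2⟩
    · exact ⟨0, contDiff_const, fun h => absurd h hn⟩
  choose w hws hwu using hw
  -- Uniform estimates serve the value, ∂₁ and both traces; ∂₂ is controlled only in L² and is
  -- handled by `eLpNorm_field_le`.
  have hunif : ∀ k, ∀ x : ℝ × ℝ, x.2 ∈ Set.Icc (-P.H) P.H → ‖(field P M (w k) - field P M u) x‖ₑ
      ≤ (Finset.Icc (-(M : ℤ)) M).card * (k : ENNReal)⁻¹ := by
    intro k x hx
    rw [field_sub]
    refine (enorm_field_le _ x).trans ?_
    refine (Finset.sum_le_card_nsmul _ _ _ fun n hn => (hwu k n hn).2 x.2 hx).trans ?_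
    rw [nsmul_eq_mul]
  have hunif₁ : ∀ k, ∀ x : ℝ × ℝ, x.2 ∈ Set.Icc (-P.H) P.H →
      ‖(pd₁ (field P M (w k)) - field P M (fun n x₂ => I * α P n * u n x₂)) x‖ₑ
      ≤ (∑ n ∈ Finset.Icc (-(M : ℤ)) M, ‖I * (α P n : ℂ)‖ₑ) * (k : ENNReal)⁻¹ := by
    intro k x hx
    rw [pd₁_field, field_sub, Finset.sum_mul]
    refine (enorm_field_le _ x).trans (Finset.sum_le_sum fun n hn => ?_)
    simp only [Pi.sub_apply, ← mul_sub]
    rw [enorm_mul]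
    gcongr
    exact (hwu k n hn).2 x.2 hx
  have hΩ : ∀ᵐ x ∂(volΩ P), x.2 ∈ Set.Icc (-P.H) P.H := by
    filter_upwards [ae_restrict_mem (measurableSet_Ioo.prod measurableSet_Ioo)] with x hx
    exact Set.Ioo_subset_Icc_self hx.2
  have hroot : ∀ {X : Type} [MeasurableSpace X] (μ : Measure X) [IsFiniteMeasure μ],
      μ Set.univ ^ (1 / 2 : ℝ) ≠ ⊤ := fun μ _ =>
    ENNReal.rpow_ne_top_of_nonneg (by norm_num) (measure_ne_top _ _)
  have hHp : P.H ∈ Set.Icc (-P.H) P.H := ⟨by linarith [P.H_pos], le_rfl⟩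
  have hHm : -P.H ∈ Set.Icc (-P.H) P.H := ⟨le_rfl, by linarith [P.H_pos]⟩
  have hcont : ∀ c : ℝ, Continuous fun x₁ => field P M u (x₁, c) := fun c =>
    continuous_finsetSum _ fun n _ => (continuous_mode P n).const_mul (u n c)
  refine ⟨⟨field P M u, _, _, _, _, memLp_field fun n hn => (hu n hn).memLp,
    memLp_field fun n hn => (hu n hn).memLp.const_mul _,
    memLp_field fun n hn => (hu n hn).memLp_deriv,
    continuous_memLp_volΓ (hcont P.H), continuous_memLp_volΓ (hcont (-P.H)),
    fun k => field P M (w k), fun k => isSmoothQP_field (hws k), ?_, ?_, ?_, ?_, ?_⟩,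
    rfl, rfl, rfl, rfl, rfl⟩
  · refine tendsto_zero_of_le_mul_inv
      (C := volΩ P Set.univ ^ (1 / 2 : ℝ) * (Finset.Icc (-(M : ℤ)) M).card)
      (ENNReal.mul_ne_top (hroot _) (by simp)) fun k => ?_
    rw [mul_assoc]
    exact eLpNorm_two_le_of_enorm_le (hΩ.mono fun x hx => hunif k x hx)
  · refine tendsto_zero_of_le_mul_inv
      (C := volΩ P Set.univ ^ (1 / 2 : ℝ) * ∑ n ∈ Finset.Icc (-(M : ℤ)) M, ‖I * (α P n : ℂ)‖ₑ)
      (ENNReal.mul_ne_top (hroot _) (ENNReal.sum_ne_top.2 fun n _ => enorm_ne_top)) fun k => ?_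
    rw [mul_assoc]
    exact eLpNorm_two_le_of_enorm_le (hΩ.mono fun x hx => hunif₁ k x hx)
  · refine tendsto_zero_of_le_mul_inv
      (C := ∑ n ∈ Finset.Icc (-(M : ℤ)) M, volΓ P Set.univ ^ (1 / 2 : ℝ))
      (ENNReal.sum_ne_top.2 fun n _ => hroot _) fun k => ?_
    rw [pd₂_field fun n => (hws k n).differentiable (by simp), field_sub, Finset.sum_mul]
    refine (eLpNorm_field_le fun n hn => ?_).trans (Finset.sum_le_sum fun n hn => ?_)
    · exact ((hws k n).continuous_deriv (by simp)).aestronglyMeasurable.sub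
        (hu n hn).memLp_deriv.1
    · gcongr
      exact (hwu k n hn).1
  all_goals
    refine tendsto_zero_of_le_mul_inv
      (C := volΓ P Set.univ ^ (1 / 2 : ℝ) * (Finset.Icc (-(M : ℤ)) M).card)
      (ENNReal.mul_ne_top (hroot _) (by simp)) fun k => ?_
    rw [mul_assoc]
    refine eLpNorm_two_le_of_enorm_le (Eventually.of_forall fun x => ?_)
  · exact hunif k (x, P.H) hHp
  · exact hunif k (x, -P.H) hHm

end Fields

/-! ### Recovering the weak derivatives of elements of V_M -/

section WeakDerivative

variable (P : Grating)

/-- `ξ'` is the weak derivative of `ξ` on `(-H,H)`, both being square-integrable. -/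
def HasWeakDeriv (ξ ξ' : ℝ → ℂ) : Prop :=
  MemLp ξ 2 (volI P) ∧ MemLp ξ' 2 (volI P) ∧
    ∀ η : ℝ → ℂ, ContDiff ℝ ∞ η → HasCompactSupport η → tsupport η ⊆ Set.Ioo (-P.H) P.H →
      ∫ t in Set.Ioo (-P.H) P.H, ξ t * deriv η t = -∫ t in Set.Ioo (-P.H) P.H, ξ' t * η t

variable {P}

lemma MemH1Interval.exists_hasWeakDeriv {ξ : ℝ → ℂ} (h : MemH1Interval P ξ) :
    ∃ ξ', HasWeakDeriv P ξ ξ' := by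
  obtain ⟨h1, ξ', h2, h3⟩ := h
  exact ⟨ξ', h1, h2, h3⟩

lemma HasWeakDeriv.zero : HasWeakDeriv P 0 0 :=
  ⟨MemLp.zero, MemLp.zero, fun η _ _ _ => by simp⟩

lemma HasWeakDeriv.const_mul {ξ ξ' : ℝ → ℂ} (h : HasWeakDeriv P ξ ξ') (c : ℂ) :
    HasWeakDeriv P (fun x => c * ξ x) (fun x => c * ξ' x) := by
  refine ⟨h.1.const_mul c, h.2.1.const_mul c, fun η h1 h2 h3 => ?_⟩
  simp only [mul_assoc, integral_const_mul, h.2.2 η h1 h2 h3, mul_neg]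

lemma HasWeakDeriv.add {ξ ξ' ζ ζ' : ℝ → ℂ} (h : HasWeakDeriv P ξ ξ') (h' : HasWeakDeriv P ζ ζ') :
    HasWeakDeriv P (ξ + ζ) (ξ' + ζ') := by
  refine ⟨h.1.add h'.1, h.2.1.add h'.2.1, fun η h1 h2 h3 => ?_⟩
  have hη : MemLp η 2 (volI P) := h1.continuous.memLp_of_hasCompactSupport h2
  have hη' : MemLp (deriv η) 2 (volI P) :=
    (h1.continuous_deriv (by simp)).memLp_of_hasCompactSupport h2.deriv
  simp only [Pi.add_apply, add_mul]
  rw [integral_add (integrable_mul_of_memLp_two h.1 hη') (integrable_mul_of_memLp_two h'.1 hη'),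
    integral_add (integrable_mul_of_memLp_two h.2.1 hη) (integrable_mul_of_memLp_two h'.2.1 hη),
    h.2.2 η h1 h2 h3, h'.2.2 η h1 h2 h3, neg_add]

lemma exists_coeff_of_mem_E {M : ℕ} {e : ℝ → ℂ} (he : e ∈ E P M) :
    ∃ c : ℤ → ℂ, e = fun x => ∑ n ∈ Finset.Icc (-(M : ℤ)) M, c n * mode P n x := by
  induction he using Submodule.span_induction with
  | mem e he =>
    obtain ⟨k, hk, rfl⟩ := he
    refine ⟨fun n => if n = k then 1 else 0, ?_⟩
    ext x
    have hk' : k ∈ Finset.Icc (-(M : ℤ)) M := by simpa using hk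
    simp [Finset.sum_ite_eq', Finset.mem_Icc.1 hk']
  | zero => exact ⟨0, by ext; simp⟩
  | add e₁ e₂ _ _ h₁ h₂ =>
    obtain ⟨c₁, rfl⟩ := h₁
    obtain ⟨c₂, rfl⟩ := h₂
    exact ⟨c₁ + c₂, by ext; simp [add_mul, Finset.sum_add_distrib]⟩
  | smul a e _ h =>
    obtain ⟨c, rfl⟩ := h
    exact ⟨a • c, by ext; simp [Finset.mul_sum, mul_assoc]⟩

/-- Elements of `V_M` are finite modal expansions with coefficients in `H¹(-H,H)`. -/
lemma exists_field_of_mem_V {M : ℕ} {v : H1qp P} (hv : v ∈ V P M) :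
    ∃ ξ ξ' : ℤ → ℝ → ℂ, (∀ n, HasWeakDeriv P (ξ n) (ξ' n)) ∧ v.val =ᵐ[volΩ P] field P M ξ := by
  obtain ⟨g, hg, hvg⟩ := hv
  suffices h : ∃ ξ ξ' : ℤ → ℝ → ℂ, (∀ n, HasWeakDeriv P (ξ n) (ξ' n)) ∧ g = field P M ξ by
    obtain ⟨ξ, ξ', h, rfl⟩ := h
    exact ⟨ξ, ξ', h, hvg⟩
  clear hvg
  induction hg using Submodule.span_induction with
  | mem g hg =>
    obtain ⟨ξ, e, hξ, he, rfl⟩ := hg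
    obtain ⟨ξ', hξ'⟩ := hξ.exists_hasWeakDeriv
    obtain ⟨c, rfl⟩ := exists_coeff_of_mem_E he
    refine ⟨fun n x => c n * ξ x, fun n x => c n * ξ' x, fun n => hξ'.const_mul (c n), ?_⟩
    ext x
    simp only [field, Finset.mul_sum]
    exact Finset.sum_congr rfl fun n _ => by ring
  | zero => exact ⟨0, 0, fun n => HasWeakDeriv.zero, by ext; simp [field]⟩
  | add g₁ g₂ _ _ h₁ h₂ =>
    obtain ⟨ξ₁, ξ₁', h₁, rfl⟩ := h₁
    obtain ⟨ξ₂, ξ₂', h₂, rfl⟩ := h₂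
    exact ⟨ξ₁ + ξ₂, ξ₁' + ξ₂', fun n => (h₁ n).add (h₂ n),
      by ext; simp [field, add_mul, Finset.sum_add_distrib]⟩
  | smul a g _ h =>
    obtain ⟨ξ, ξ', h, rfl⟩ := h
    refine ⟨fun n x => a * ξ n x, fun n x => a * ξ' n x, fun n => (h n).const_mul a, ?_⟩
    ext
    simp [field, Finset.mul_sum, mul_assoc]

lemma field_mem_span {M : ℕ} {u : ℤ → ℝ → ℂ}
    (hu : ∀ n ∈ Finset.Icc (-(M : ℤ)) M, MemH1Interval P (u n)) :
    field P M u ∈ Submodule.span ℂ {g : ℝ × ℝ → ℂ | ∃ ξ e : ℝ → ℂ, MemH1Interval P ξ ∧ e ∈ E P M ∧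
      g = fun x => ξ x.2 * e x.1} := by
  have h : field P M u = ∑ n ∈ Finset.Icc (-(M : ℤ)) M,
      fun x : ℝ × ℝ => u n x.2 * mode P n x.1 := by
    ext x; simp [field]
  rw [h]
  refine Submodule.sum_mem _ fun n hn => Submodule.subset_span ⟨u n, mode P n, hu n hn, ?_, rfl⟩
  exact Submodule.subset_span ⟨n, by simpa using hn, rfl⟩

lemma pd₁_eq_fderiv {φ : ℝ × ℝ → ℂ} (hφ : Differentiable ℝ φ) (x : ℝ × ℝ) :
    pd₁ φ x = fderiv ℝ φ x (1, 0) := by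
  have h : HasDerivAt (fun s : ℝ => (s, x.2)) ((1 : ℝ), (0 : ℝ)) x.1 :=
    (hasDerivAt_id x.1).prodMk (hasDerivAt_const _ _)
  exact ((hφ x).hasFDerivAt.comp_hasDerivAt x.1 h).deriv

lemma pd₂_eq_fderiv {φ : ℝ × ℝ → ℂ} (hφ : Differentiable ℝ φ) (x : ℝ × ℝ) :
    pd₂ φ x = fderiv ℝ φ x (0, 1) := by
  have h : HasDerivAt (fun s : ℝ => (x.1, s)) ((0 : ℝ), (1 : ℝ)) x.2 :=
    (hasDerivAt_const _ _).prodMk (hasDerivAt_id x.2)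
  exact ((hφ x).hasFDerivAt.comp_hasDerivAt x.2 h).deriv

lemma continuous_pd₁ {φ : ℝ × ℝ → ℂ} (hφ : ContDiff ℝ ∞ φ) : Continuous (pd₁ φ) := by
  rw [funext (pd₁_eq_fderiv (hφ.differentiable (by simp)))]
  exact (hφ.continuous_fderiv (by simp)).clm_apply continuous_const

lemma continuous_pd₂ {φ : ℝ × ℝ → ℂ} (hφ : ContDiff ℝ ∞ φ) : Continuous (pd₂ φ) := by
  rw [funext (pd₂_eq_fderiv (hφ.differentiable (by simp)))]
  exact (hφ.continuous_fderiv (by simp)).clm_apply continuous_const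

lemma fderiv_eq_zero_of_notMem {η : ℝ × ℝ → ℂ} {U : Set (ℝ × ℝ)} (hs : tsupport η ⊆ U)
    {x : ℝ × ℝ} (hx : x ∉ U) : fderiv ℝ η x = 0 :=
  image_eq_zero_of_notMem_tsupport fun h => hx (hs (tsupport_fderiv_subset ℝ h))

/-- Integration by parts in `Ω` for a smooth function and a test function. -/
lemma integral_fderiv_mul_eq_neg {φ η : ℝ × ℝ → ℂ} (hφ : ContDiff ℝ ∞ φ) (hη : ContDiff ℝ ∞ η)
    (hc : HasCompactSupport η) (hs : tsupport η ⊆ Omega P) (v : ℝ × ℝ) :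
    ∫ x, fderiv ℝ η x v * φ x ∂(volΩ P) = -∫ x, η x * fderiv ℝ φ x v ∂(volΩ P) := by
  have hφ' : Continuous fun x => fderiv ℝ φ x v :=
    (hφ.continuous_fderiv (by simp)).clm_apply continuous_const
  have hη' : Continuous fun x => fderiv ℝ η x v :=
    (hη.continuous_fderiv (by simp)).clm_apply continuous_const
  have hcη' : HasCompactSupport fun x => fderiv ℝ η x v := hc.fderiv_apply ℝ v
  have h := integral_mul_fderiv_eq_neg_fderiv_mul_of_integrable (μ := volume) (f := η) (g := φ)
    (v := v) ((hη'.mul hφ.continuous).integrable_of_hasCompactSupport hcη'.mul_right)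
    ((hη.continuous.mul hφ').integrable_of_hasCompactSupport hc.mul_right)
    ((hη.continuous.mul hφ.continuous).integrable_of_hasCompactSupport hc.mul_right)
    (fun x _ => hη.differentiable (by simp) x) (fun x _ => hφ.differentiable (by simp) x)
  rw [volΩ, setIntegral_eq_integral_of_forall_compl_eq_zero,
    setIntegral_eq_integral_of_forall_compl_eq_zero, h, neg_neg]
  · intro x hx
    rw [image_eq_zero_of_notMem_tsupport fun h => hx (hs h), zero_mul]
  · intro x hx
    rw [fderiv_eq_zero_of_notMem hs hx]; simp

/-- Classical integration by parts for the approximants passes to the L² limit, so `d₁` is a genuine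
weak derivative. -/
lemma H1qp.integral_pd₁_mul_val (v : H1qp P) {η : ℝ × ℝ → ℂ} (hη : ContDiff ℝ ∞ η)
    (hc : HasCompactSupport η) (hs : tsupport η ⊆ Omega P) :
    ∫ x, pd₁ η x * v.val x ∂(volΩ P) = -∫ x, η x * v.d₁ x ∂(volΩ P) := by
  obtain ⟨φ, hφ, h0, h1, -⟩ := v.approx
  have hl := tendsto_integral_mul_of_eLpNorm_two (continuous_memLp_volΩ (continuous_pd₁ hη))
    v.memLp_val (fun k => continuous_memLp_volΩ (hφ k).1.continuous) h0
  have hr := tendsto_integral_mul_of_eLpNorm_two (continuous_memLp_volΩ hη.continuous)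
    v.memLp_d₁ (fun k => continuous_memLp_volΩ (continuous_pd₁ (hφ k).1)) h1
  refine tendsto_nhds_unique hl (hr.neg.congr fun k => ?_)
  simp only [pd₁_eq_fderiv (hη.differentiable (by simp)),
    pd₁_eq_fderiv ((hφ k).1.differentiable (by simp))]
  exact (integral_fderiv_mul_eq_neg (hφ k).1 hη hc hs _).symm

lemma H1qp.integral_pd₂_mul_val (v : H1qp P) {η : ℝ × ℝ → ℂ} (hη : ContDiff ℝ ∞ η)
    (hc : HasCompactSupport η) (hs : tsupport η ⊆ Omega P) :
    ∫ x, pd₂ η x * v.val x ∂(volΩ P) = -∫ x, η x * v.d₂ x ∂(volΩ P) := by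
  obtain ⟨φ, hφ, h0, -, h2, -⟩ := v.approx
  have hl := tendsto_integral_mul_of_eLpNorm_two (continuous_memLp_volΩ (continuous_pd₂ hη))
    v.memLp_val (fun k => continuous_memLp_volΩ (hφ k).1.continuous) h0
  have hr := tendsto_integral_mul_of_eLpNorm_two (continuous_memLp_volΩ hη.continuous)
    v.memLp_d₂ (fun k => continuous_memLp_volΩ (continuous_pd₂ (hφ k).1)) h2
  refine tendsto_nhds_unique hl (hr.neg.congr fun k => ?_)
  simp only [pd₂_eq_fderiv (hη.differentiable (by simp)),
    pd₂_eq_fderiv ((hφ k).1.differentiable (by simp))]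
  exact (integral_fderiv_mul_eq_neg (hφ k).1 hη hc hs _).symm

/-- With the x₁-integral innermost, ξ(x₂) is a constant, so square-integrability suffices; the
boundary values vanish because η is supported in the open cell. -/
lemma integral_pd₁_mul_mode {ξ : ℝ → ℂ} (hξ : MemLp ξ 2 (volI P)) (n : ℤ)
    {η : ℝ × ℝ → ℂ} (hη : ContDiff ℝ ∞ η) (hs : tsupport η ⊆ Omega P) :
    ∫ x, pd₁ η x * (ξ x.2 * mode P n x.1) ∂(volΩ P)
      = -∫ x, η x * (I * α P n * ξ x.2 * mode P n x.1) ∂(volΩ P) := by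
  have hi1 := integrable_mul_of_memLp_two (continuous_memLp_volΩ (P := P) (continuous_pd₁ hη))
    (memLp_mul_mode hξ n)
  have hi2 := integrable_mul_of_memLp_two (continuous_memLp_volΩ (P := P) hη.continuous)
    (memLp_mul_mode (hξ.const_mul (I * α P n)) n)
  rw [eq_neg_iff_add_eq_zero, ← integral_add hi1 hi2]
  have hi := hi1.add hi2
  rw [volΩ_eq_prod] at hi ⊢
  refine (integral_prod_symm _ hi).trans ?_
  have hin : ∀ y : ℝ, ∫ x, (pd₁ η (x, y) * (ξ y * mode P n x)
      + η (x, y) * (I * α P n * ξ y * mode P n x)) ∂(volΓ P) = 0 := by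
    intro y
    have hd : ∀ x : ℝ, HasDerivAt (fun s => η (s, y) * (ξ y * mode P n s))
        (pd₁ η (x, y) * (ξ y * mode P n x) + η (x, y) * (I * α P n * ξ y * mode P n x)) x := by
      intro x
      have h1 : HasDerivAt (fun s => η (s, y)) (pd₁ η (x, y)) x :=
        DifferentiableAt.hasDerivAt (f := fun s => η (s, y)) (by
          have := hη.differentiable (by simp)
          fun_prop)
      exact (h1.mul ((hasDerivAt_mode P n x).const_mul (ξ y))).congr_deriv (by ring)
    have hcont : Continuous fun x : ℝ => pd₁ η (x, y) * (ξ y * mode P n x)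
        + η (x, y) * (I * α P n * ξ y * mode P n x) := by
      have h1 := continuous_pd₁ hη
      have h2 := hη.continuous
      have h3 := continuous_mode P n
      fun_prop
    rw [volΓ, ← integral_Ioc_eq_integral_Ioo, ← intervalIntegral.integral_of_le P.L_pos.le,
      intervalIntegral.integral_eq_sub_of_hasDerivAt (fun x _ => hd x)
        (hcont.intervalIntegrable _ _),
      image_eq_zero_of_notMem_tsupport (f := η) (x := (P.L, y)) fun h => by simpa using (hs h).1,
      image_eq_zero_of_notMem_tsupport (f := η) (x := (0, y)) fun h => by simpa using (hs h).1]
    simp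
  exact (integral_congr_ae (Eventually.of_forall hin)).trans (by simp)

/-- With the x₂-integral innermost, η(x₁, ·) is a test function on (-H,H) and the weak derivative of
ξ applies on each line. -/
lemma integral_pd₂_mul_mode {ξ ξ' : ℝ → ℂ} (hξ : HasWeakDeriv P ξ ξ') (n : ℤ)
    {η : ℝ × ℝ → ℂ} (hη : ContDiff ℝ ∞ η) (hc : HasCompactSupport η) (hs : tsupport η ⊆ Omega P) :
    ∫ x, pd₂ η x * (ξ x.2 * mode P n x.1) ∂(volΩ P)
      = -∫ x, η x * (ξ' x.2 * mode P n x.1) ∂(volΩ P) := by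
  have hi1 := (continuous_memLp_volΩ (P := P) (continuous_pd₂ hη)).integrable_mul
    (memLp_mul_mode hξ.1 n)
  have hi2 := (continuous_memLp_volΩ (P := P) hη.continuous).integrable_mul
    (memLp_mul_mode hξ.2.1 n)
  rw [volΩ_eq_prod] at hi1 hi2 ⊢
  refine (integral_prod _ hi1).trans (Eq.trans ?_ (congrArg Neg.neg (integral_prod _ hi2).symm))
  rw [← integral_neg]
  refine integral_congr_ae (Eventually.of_forall fun x => ?_)
  have hemb : ContDiff ℝ ∞ fun t : ℝ => η (x, t) := hη.comp (contDiff_prodMk_right x)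
  have hts : tsupport (fun t : ℝ => η (x, t)) ⊆ (fun t : ℝ => (x, t)) ⁻¹' tsupport η :=
    closure_minimal (fun t ht => subset_tsupport _ ht)
      ((isClosed_tsupport η).preimage (by fun_prop))
  have hcs : HasCompactSupport fun t : ℝ => η (x, t) := by
    refine HasCompactSupport.of_support_subset_isCompact (hc.isCompact.image continuous_snd) ?_
    exact fun t ht => ⟨(x, t), subset_tsupport _ ht, rfl⟩
  have h := hξ.2.2 _ hemb hcs fun t ht => (hs (hts ht)).2
  have e1 : ∀ t, pd₂ η (x, t) * (ξ t * mode P n x)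
      = mode P n x * (ξ t * deriv (fun t => η (x, t)) t) := fun t => by
    rw [pd₂]; ring
  have e2 : ∀ t, η (x, t) * (ξ' t * mode P n x) = mode P n x * (ξ' t * η (x, t)) := fun t => by
    ring
  simp only [Pi.mul_apply, e1, e2, integral_const_mul]
  rw [h, mul_neg]

lemma integral_mul_field {M : ℕ} {G : ℝ × ℝ → ℂ} {g : ℤ → ℝ → ℂ} (hG : MemLp G 2 (volΩ P))
    (hg : ∀ n ∈ Finset.Icc (-(M : ℤ)) M, MemLp (g n) 2 (volI P)) :
    ∫ x, G x * field P M g x ∂(volΩ P)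
      = ∑ n ∈ Finset.Icc (-(M : ℤ)) M, ∫ x, G x * (g n x.2 * mode P n x.1) ∂(volΩ P) := by
  simp only [field, Finset.mul_sum]
  exact integral_finsetSum _ fun n hn => hG.integrable_mul (memLp_mul_mode (hg n hn) n)

/-- Two square-integrable functions on `Ω` with the same integrals against test functions agree. -/
lemma ae_eq_of_forall_integral_mul_eq {f g : ℝ × ℝ → ℂ} (hf : MemLp f 2 (volΩ P))
    (hg : MemLp g 2 (volΩ P))
    (h : ∀ η : ℝ × ℝ → ℂ, ContDiff ℝ ∞ η → HasCompactSupport η → tsupport η ⊆ Omega P →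
      ∫ x, η x * f x ∂(volΩ P) = ∫ x, η x * g x ∂(volΩ P)) : f =ᵐ[volΩ P] g := by
  have hopen : IsOpen (Omega P) := isOpen_Ioo.prod isOpen_Ioo
  have hint : IntegrableOn (f - g) (Omega P) volume := (hf.sub hg).integrable (by norm_num)
  have key := hopen.ae_eq_zero_of_integral_contDiff_smul_eq_zero hint.locallyIntegrableOn
    (fun η hη hc hs => ?_)
  · rw [volΩ, EventuallyEq, ae_restrict_iff' hopen.measurableSet]
    filter_upwards [key] with x hx hxΩ
    exact sub_eq_zero.1 (hx hxΩ)
  · have hs' : tsupport (fun x => (η x : ℂ)) ⊆ Omega P :=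
      (closure_mono fun x hx => by simpa using hx).trans hs
    have hη' : ContDiff ℝ ∞ fun x => (η x : ℂ) := ofRealCLM.contDiff.comp hη
    have hc' : HasCompactSupport fun x => (η x : ℂ) := hc.comp_left (g := fun r : ℝ => (r : ℂ)) rfl
    have hm := continuous_memLp_volΩ (P := P) hη'.continuous
    rw [← setIntegral_eq_integral_of_forall_compl_eq_zero (s := Omega P) fun x hx => by
      rw [image_eq_zero_of_notMem_tsupport fun h => hx (hs h), zero_smul]]
    have := integral_sub (hm.integrable_mul hf) (hm.integrable_mul hg)
    simp only [Pi.mul_apply, h _ hη' hc' hs', sub_self] at this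
    rw [← this]
    refine integral_congr_ae (Eventually.of_forall fun x => ?_)
    simp [mul_sub]

/-- Both sides are square-integrable weak x₁-derivatives of the same function, hence equal almost
everywhere. -/
lemma d₁_ae_eq_field {M : ℕ} {v : H1qp P} {ξ : ℤ → ℝ → ℂ} (hξ : ∀ n, MemLp (ξ n) 2 (volI P))
    (hv : v.val =ᵐ[volΩ P] field P M ξ) :
    v.d₁ =ᵐ[volΩ P] field P M (fun n x₂ => I * α P n * ξ n x₂) := by
  have hξ' : ∀ n, MemLp (fun x₂ => I * α P n * ξ n x₂) 2 (volI P) := fun n => (hξ n).const_mul _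
  refine ae_eq_of_forall_integral_mul_eq v.memLp_d₁ (memLp_field fun n _ => hξ' n)
    fun η hη hc hs => ?_
  rw [← neg_inj, ← v.integral_pd₁_mul_val hη hc hs,
    integral_congr_ae (hv.mono fun x hx => congrArg (pd₁ η x * ·) hx),
    integral_mul_field (continuous_memLp_volΩ (continuous_pd₁ hη)) fun n _ => hξ n,
    integral_mul_field (continuous_memLp_volΩ hη.continuous) fun n _ => hξ' n,
    ← Finset.sum_neg_distrib]
  exact Finset.sum_congr rfl fun n _ => integral_pd₁_mul_mode (hξ n) n hη hs

lemma d₂_ae_eq_field {M : ℕ} {v : H1qp P} {ξ ξ' : ℤ → ℝ → ℂ}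
    (hξ : ∀ n, HasWeakDeriv P (ξ n) (ξ' n)) (hv : v.val =ᵐ[volΩ P] field P M ξ) :
    v.d₂ =ᵐ[volΩ P] field P M ξ' := by
  refine ae_eq_of_forall_integral_mul_eq v.memLp_d₂ (memLp_field fun n _ => (hξ n).2.1)
    fun η hη hc hs => ?_
  rw [← neg_inj, ← v.integral_pd₂_mul_val hη hc hs,
    integral_congr_ae (hv.mono fun x hx => congrArg (pd₂ η x * ·) hx),
    integral_mul_field (continuous_memLp_volΩ (continuous_pd₂ hη)) fun n _ => (hξ n).1,
    integral_mul_field (continuous_memLp_volΩ hη.continuous) fun n _ => (hξ n).2.1,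
    ← Finset.sum_neg_distrib]
  exact Finset.sum_congr rfl fun n _ => integral_pd₂_mul_mode (hξ n) n hη hc hs

end WeakDerivative

/-! ### Modal expansion of pairings and integration by parts with traces -/

section Pairing

variable {P : Grating} {M : ℕ}

lemma L_mul_conj_qpCoeff (n : ℤ) (φ : ℝ → ℂ) :
    P.L * conj (qpCoeff P n φ) = ∫ x, mode P n x * conj (φ x) ∂(volΓ P) := by
  have h := congrArg conj (L_mul_qpCoeff P n φ)
  rw [map_mul, conj_ofReal, ← integral_conj] at h
  rw [h]
  refine integral_congr_ae (Eventually.of_forall fun x => ?_)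
  simp [mul_comm]

lemma qpCoeff_sub {φ ψ : ℝ → ℂ} (n : ℤ) (hφ : MemLp φ 2 (volΓ P)) (hψ : MemLp ψ 2 (volΓ P)) :
    qpCoeff P n (fun x => φ x - ψ x) = qpCoeff P n φ - qpCoeff P n ψ := by
  have hL : (P.L : ℂ) ≠ 0 := by exact_mod_cast P.L_pos.ne'
  apply mul_left_cancel₀ hL
  rw [mul_sub, L_mul_qpCoeff, L_mul_qpCoeff, L_mul_qpCoeff, ← integral_sub
    (integrable_mul_conj_of_memLp_two hφ (memLp_mode P n))
    (integrable_mul_conj_of_memLp_two hψ (memLp_mode P n))]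
  simp only [sub_mul]

lemma qpCoeff_const_mul (n : ℤ) (c : ℂ) (φ : ℝ → ℂ) :
    qpCoeff P n (fun x => c * φ x) = c * qpCoeff P n φ := by
  simp only [qpCoeff, mul_assoc, integral_const_mul]
  ring

lemma qpCoeff_sum {s : Finset ℤ} (n : ℤ) {φ : ℤ → ℝ → ℂ} (hφ : ∀ m ∈ s, MemLp (φ m) 2 (volΓ P)) :
    qpCoeff P n (fun x => ∑ m ∈ s, φ m x) = ∑ m ∈ s, qpCoeff P n (φ m) := by
  have hL : (P.L : ℂ) ≠ 0 := by exact_mod_cast P.L_pos.ne'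
  apply mul_left_cancel₀ hL
  simp only [Finset.mul_sum, L_mul_qpCoeff, Finset.sum_mul]
  exact integral_finsetSum _ fun m hm => integrable_mul_conj_of_memLp_two (hφ m hm) (memLp_mode P n)

lemma qpCoeff_field (g : ℤ → ℝ → ℂ) (n : ℤ) (y : ℝ) :
    qpCoeff P n (fun x => field P M g (x, y)) = if n ∈ Finset.Icc (-(M : ℤ)) M then g n y else 0 := by
  simp only [field]
  rw [qpCoeff_sum n fun m _ => (memLp_mode P m).const_mul (g m y)]
  simp only [qpCoeff_const_mul, qpCoeff_mode, mul_ite, mul_one, mul_zero]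
  rw [Finset.sum_ite_eq']

/-- Modal expansion of the `L²(Ω)` product with a finite modal sum. -/
lemma integral_mul_conj_field {K : ℝ × ℝ → ℂ} {g : ℤ → ℝ → ℂ} (hK : MemLp K 2 (volΩ P))
    (hg : ∀ n ∈ Finset.Icc (-(M : ℤ)) M, MemLp (g n) 2 (volI P)) :
    ∫ x, K x * conj (field P M g x) ∂(volΩ P) = P.L * ∑ n ∈ Finset.Icc (-(M : ℤ)) M,
      ∫ y, qpCoeff P n (fun x => K (x, y)) * conj (g n y) ∂(volI P) := by
  have hi : ∀ n ∈ Finset.Icc (-(M : ℤ)) M,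
      Integrable (fun x : ℝ × ℝ => K x * conj (g n x.2 * mode P n x.1)) (volΩ P) := fun n hn =>
    integrable_mul_conj_of_memLp_two hK (memLp_mul_mode (hg n hn) n)
  simp only [field, map_sum, Finset.mul_sum]
  rw [integral_finsetSum _ hi]
  refine Finset.sum_congr rfl fun n hn => ?_
  have hin := hi n hn
  rw [volΩ_eq_prod] at hin ⊢
  rw [integral_prod_symm _ hin, ← integral_const_mul]
  refine integral_congr_ae (Eventually.of_forall fun y => ?_)
  simp only
  rw [← mul_assoc, L_mul_qpCoeff, ← integral_mul_const]
  refine integral_congr_ae (Eventually.of_forall fun x => ?_)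
  simp only [map_mul]
  ring

lemma integral_mode_mul_conj_field {f : ℝ → ℂ} {g : ℤ → ℝ → ℂ} (hf : MemLp f 2 (volI P))
    (hg : ∀ n ∈ Finset.Icc (-(M : ℤ)) M, MemLp (g n) 2 (volI P))
    {n : ℤ} (hn : n ∈ Finset.Icc (-(M : ℤ)) M) :
    ∫ x, (f x.2 * mode P n x.1) * conj (field P M g x) ∂(volΩ P)
      = P.L * ∫ y, f y * conj (g n y) ∂(volI P) := by
  rw [integral_mul_conj_field (memLp_mul_mode hf n) hg]
  simp only [qpCoeff_const_mul, qpCoeff_mode]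
  rw [Finset.sum_eq_single n (fun m _ hm => by simp [hm.symm]) (fun h => absurd hn h)]
  simp

/-- Integration by parts in `x₂` against `F(x₂) exp(i α_n x₁)`, with the boundary terms given by the
traces. -/
lemma H1qp.integral_piecewiseC1_mul_mode {T : Mesh P} (v : H1qp P) {F : ℝ → ℂ}
    (hF : T.PiecewiseC1 F) (n : ℤ) :
    ∫ x, (deriv F x.2 * mode P n x.1) * conj (v.val x) ∂(volΩ P)
      + ∫ x, (F x.2 * mode P n x.1) * conj (v.d₂ x) ∂(volΩ P)
      = P.L * (F P.H * conj (qpCoeff P n v.top) - F (-P.H) * conj (qpCoeff P n v.bot)) := by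
  obtain ⟨φ, hφ, h0, -, h2, ht, hb⟩ := v.approx
  have hct : ∀ k c, Continuous fun x₁ => φ k (x₁, c) := fun k c => by
    have := (hφ k).1.continuous
    fun_prop
  have l0 := tendsto_integral_mul_conj_of_eLpNorm_two (memLp_mul_mode hF.memLp_deriv n)
    v.memLp_val (fun k => continuous_memLp_volΩ (hφ k).1.continuous) h0
  have l2 := tendsto_integral_mul_conj_of_eLpNorm_two (memLp_mul_mode hF.memLp n)
    v.memLp_d₂ (fun k => continuous_memLp_volΩ (continuous_pd₂ (hφ k).1)) h2
  have lt := tendsto_integral_mul_conj_of_eLpNorm_two (memLp_mode P n)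
    v.memLp_top (fun k => continuous_memLp_volΓ (hct k P.H)) ht
  have lb := tendsto_integral_mul_conj_of_eLpNorm_two (memLp_mode P n)
    v.memLp_bot (fun k => continuous_memLp_volΓ (hct k (-P.H))) hb
  rw [mul_sub, mul_left_comm, L_mul_conj_qpCoeff, mul_left_comm, L_mul_conj_qpCoeff]
  -- Both sides are limits along `approx`, the traces included. For a smooth φ k, Fubini reduces the
  -- identity to `integral_deriv_mul_add` on each line of constant x₁.
  refine tendsto_nhds_unique (l0.add l2) (((lt.const_mul _).sub (lb.const_mul _)).congr fun k => ?_)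
  have i0 := integrable_mul_conj_of_memLp_two (memLp_mul_mode hF.memLp_deriv n)
    (continuous_memLp_volΩ (P := P) (hφ k).1.continuous)
  have i2 := integrable_mul_conj_of_memLp_two (memLp_mul_mode hF.memLp n)
    (continuous_memLp_volΩ (P := P) (continuous_pd₂ (hφ k).1))
  have it := integrable_mul_conj_of_memLp_two (memLp_mode P n)
    (continuous_memLp_volΓ (P := P) (hct k P.H))
  have ib := integrable_mul_conj_of_memLp_two (memLp_mode P n)
    (continuous_memLp_volΓ (P := P) (hct k (-P.H)))
  refine Eq.trans ?_ (integral_add i0 i2)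
  have i02 := i0.add i2
  rw [volΩ_eq_prod] at i02 ⊢
  refine Eq.trans ?_ (integral_prod _ i02).symm
  rw [← integral_const_mul, ← integral_const_mul]
  refine (integral_sub (it.const_mul _) (ib.const_mul _)).symm.trans ?_
  refine integral_congr_ae (Eventually.of_forall fun x => ?_)
  have hsm : ContDiff ℝ ∞ fun t : ℝ => φ k (x, t) := (hφ k).1.comp (contDiff_prodMk_right x)
  have ha : ContDiff ℝ 1 fun t : ℝ => mode P n x * conj (φ k (x, t)) :=
    contDiff_const.mul (conjCLE.contDiff.comp (hsm.of_le (by exact_mod_cast le_top)))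
  have hda : ∀ t, deriv (fun t : ℝ => mode P n x * conj (φ k (x, t))) t
      = mode P n x * conj (pd₂ (φ k) (x, t)) := fun t =>
    ((hsm.differentiable (by simp) t).hasDerivAt.star.const_mul (mode P n x)).deriv
  have h := hF.integral_deriv_mul_add ha
  simp only [hda] at h
  refine Eq.trans h.symm (integral_congr_ae (Eventually.of_forall fun t => ?_))
  simp only [Pi.add_apply]
  ring

end Pairing

/-! ### Laurent's rule in a slice and the incident field -/

section Slices

variable {P : Grating} {T : Mesh P} {M : ℕ}

lemma exists_norm_one_div_ε_le (P : Grating) : ∃ C, ∀ x, ‖1 / P.ε x‖ ≤ C := by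
  obtain ⟨c, hc, h⟩ := P.re_ε
  refine ⟨1 / c, fun x => ?_⟩
  rw [norm_div, norm_one]
  exact one_div_le_one_div_of_le hc ((h x).trans (re_le_norm _))

lemma Mesh.measurable_sliceε (j : ℕ) : Measurable (T.sliceε j) :=
  P.measurable_ε.comp (by fun_prop)

lemma Mesh.measurable_εh : Measurable T.εh := by
  refine Finset.measurable_sum _ fun j _ => ?_
  exact Measurable.ite (measurable_snd measurableSet_Ioo)
    ((T.measurable_sliceε j).comp measurable_fst) measurable_const

lemma Mesh.εh_eq {j : ℕ} (hj : j < T.S) {x : ℝ × ℝ}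
    (hx : x.2 ∈ Set.Ioo (T.node j) (T.node (j + 1))) : T.εh x = T.sliceε j x.1 := by
  rw [Mesh.εh, Finset.sum_eq_single j, if_pos hx]
  · intro i hi hij
    exact if_neg (T.not_mem_slice hij (Finset.mem_range.1 hi) hj hx)
  · intro h
    exact absurd (Finset.mem_range.2 hj) h

lemma memLp_one_div_εh_mul {f : ℝ × ℝ → ℂ} (hf : MemLp f 2 (volΩ P)) :
    MemLp (fun x => 1 / T.εh x * f x) 2 (volΩ P) := by
  obtain ⟨C, hC⟩ := exists_norm_one_div_ε_le P
  refine hf.of_le_mul (c := C)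
    ((T.measurable_εh.const_div 1).aestronglyMeasurable.mul hf.1) ?_
  have hsl : ∀ᵐ x ∂(volΩ P), ∃ j < T.S, x.2 ∈ Set.Ioo (T.node j) (T.node (j + 1)) := by
    rw [volΩ_eq_prod]
    exact Measure.quasiMeasurePreserving_snd.ae T.ae_mem_slice
  filter_upwards [hsl] with x ⟨j, hj, hx⟩
  rw [T.εh_eq hj hx, norm_mul]
  exact mul_le_mul_of_nonneg_right (hC _) (norm_nonneg _)

lemma memLp_one_div_sliceε_mul_mode (j : ℕ) (m : ℤ) (c : ℂ) :
    MemLp (fun x => 1 / T.sliceε j x * (c * mode P m x)) 2 (volΓ P) := by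
  obtain ⟨C, hC⟩ := exists_norm_one_div_ε_le P
  have hf := (memLp_mode P m).const_mul c
  refine hf.of_le_mul (c := C)
    (((T.measurable_sliceε j).const_div 1).aestronglyMeasurable.mul hf.1) ?_
  refine Eventually.of_forall fun x => ?_
  rw [norm_mul]
  exact mul_le_mul_of_nonneg_right (hC _) (norm_nonneg _)

lemma memLp_one_div_sliceε_mul_field (j : ℕ) (g : ℤ → ℝ → ℂ) (y : ℝ) :
    MemLp (fun x => 1 / T.sliceε j x * field P M g (x, y)) 2 (volΓ P) := by
  simp only [field, Finset.mul_sum]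
  exact memLp_finsetSum _ fun m _ => memLp_one_div_sliceε_mul_mode j m (g m y)

lemma memLp_field_slice (g : ℤ → ℝ → ℂ) (y : ℝ) :
    MemLp (fun x => field P M g (x, y)) 2 (volΓ P) :=
  memLp_finsetSum _ fun m _ => (memLp_mode P m).const_mul (g m y)

/-- Laurent's rule for the product of `1/ε_h` with a finite modal sum. -/
lemma Mesh.qpCoeff_one_div_sliceε_mul_field (j : ℕ) (g : ℤ → ℝ → ℂ) (n : ℤ) (y : ℝ) :
    qpCoeff P n (fun x => 1 / T.sliceε j x * field P M g (x, y))
      = ∑ m ∈ Finset.Icc (-(M : ℤ)) M, T.invεCoeff j (n - m) * g m y := by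
  simp only [field, Finset.mul_sum]
  rw [qpCoeff_sum n fun m _ => memLp_one_div_sliceε_mul_mode j m (g m y)]
  refine Finset.sum_congr rfl fun m _ => ?_
  have hL : (P.L : ℂ) ≠ 0 := by exact_mod_cast P.L_pos.ne'
  apply mul_left_cancel₀ hL
  rw [L_mul_qpCoeff, Mesh.invεCoeff, ← mul_assoc, ← mul_assoc, mul_one_div_cancel hL, one_mul,
    ← integral_mul_const]
  refine integral_congr_ae (Eventually.of_forall fun x => ?_)
  simp only
  rw [← mode_mul_conj_mode]
  ring

lemma contDiff_incCoeff (n : ℤ) : ContDiff ℝ ∞ (incCoeff P n) := by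
  unfold incCoeff
  split_ifs
  · have h : ContDiff ℝ ∞ (fun y : ℝ => (y : ℂ)) := ofRealCLM.contDiff
    exact (contDiff_const.mul h).neg.cexp
  · exact contDiff_const

/-- Since α_0 = κ√ε₊ sin θ, the incident wave is the mode n = 0 alone and is a finite expansion for
every M. -/
lemma uinc_eq_field (M : ℕ) : uinc P = field P M (incCoeff P) := by
  ext x
  rw [field, Finset.sum_eq_single 0 (fun m _ hm => by simp [incCoeff, hm]) (by simp)]
  simp only [uinc, incCoeff, mode, α, if_true]
  rw [← exp_add]
  congr 1
  push_cast
  ring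

lemma pd₁_uinc (M : ℕ) :
    pd₁ (uinc P) = field P M (fun n x₂ => I * α P n * incCoeff P n x₂) := by
  rw [uinc_eq_field M, pd₁_field]

lemma pd₂_uinc (M : ℕ) : pd₂ (uinc P) = field P M (fun n => deriv (incCoeff P n)) := by
  rw [uinc_eq_field M, pd₂_field fun n => (contDiff_incCoeff n).differentiable (by simp)]

lemma Mesh.qpCoeff_contrast_mul_field (j : ℕ) (g : ℤ → ℝ → ℂ) {n : ℤ}
    (hn : n ∈ Finset.Icc (-(M : ℤ)) M) (y : ℝ) :
    qpCoeff P n (fun x => (1 / (P.εp : ℂ) - 1 / T.sliceε j x) * field P M g (x, y))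
      = 1 / (P.εp : ℂ) * g n y
        - ∑ m ∈ Finset.Icc (-(M : ℤ)) M, T.invεCoeff j (n - m) * g m y := by
  simp only [sub_mul]
  rw [qpCoeff_sub n ((memLp_field_slice g y).const_mul _) (memLp_one_div_sliceε_mul_field j g y),
    qpCoeff_const_mul, T.qpCoeff_one_div_sliceε_mul_field, qpCoeff_field, if_pos hn]

/-- Laurent's rule makes the source explicit: its c_{n-m} terms complete u to the total field in
`ode`, and its ε₊⁻¹ terms are those subtracted in the scattered flux. -/
lemma Mesh.sourceCoeff_eq (j : ℕ) {n : ℤ} (hn : n ∈ Finset.Icc (-(M : ℤ)) M) (y : ℝ) :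
    T.sourceCoeff j n y
      = I * α P n * (1 / (P.εp : ℂ) * (I * α P n * incCoeff P n y)
          - ∑ m ∈ Finset.Icc (-(M : ℤ)) M, T.invεCoeff j (n - m) * (I * α P m * incCoeff P m y))
        + (1 / (P.εp : ℂ) * deriv (deriv (incCoeff P n)) y
          - ∑ m ∈ Finset.Icc (-(M : ℤ)) M,
              T.invεCoeff j (n - m) * deriv (deriv (incCoeff P m)) y) := by
  have hd : ∀ m : ℤ, HasDerivAt (deriv (incCoeff P m)) (deriv (deriv (incCoeff P m)) y) y :=
    fun m => ((contDiff_infty_iff_deriv.1 (contDiff_incCoeff m)).2.differentiable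
      (by simp) y).hasDerivAt
  simp only [Mesh.sourceCoeff, pd₁_uinc M, pd₂_uinc M]
  rw [T.qpCoeff_contrast_mul_field j _ hn]
  simp only [T.qpCoeff_contrast_mul_field j _ hn]
  congr 1
  exact (((hd n).const_mul _).sub (HasDerivAt.fun_sum fun m _ => (hd m).const_mul _)).deriv

end Slices

/-! ### The scattered flux and the Galerkin identity -/

section Galerkin

variable {P : Grating} {T : Mesh P} {M : ℕ} {u : ℤ → ℝ → ℂ} {r t : ℤ → ℂ}

lemma Mesh.IsSolution.piecewiseC1 (hu : T.IsSolution M u r t) {n : ℤ}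
    (hn : n ∈ Finset.Icc (-(M : ℤ)) M) : T.PiecewiseC1 (u n) :=
  ⟨hu.continuousOn n hn, fun j hj => (hu.contDiffOn n hn j hj).of_le (by norm_num)⟩

/-- The scattered flux `∑ c_{n-m} (u_m + u^inc_m)' - ε₊⁻¹ (u^inc_n)'` as a single function on
`[-H,H]`. -/
lemma Mesh.IsSolution.exists_scatteredFlux (hu : T.IsSolution M u r t) {n : ℤ}
    (hn : n ∈ Finset.Icc (-(M : ℤ)) M) :
    ∃ F, T.PiecewiseC1 F ∧ ∀ j < T.S, ∀ x ∈ Set.Icc (T.node j) (T.node (j + 1)),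
      F x = T.totalFlux M u j n x - 1 / (P.εp : ℂ) * deriv (incCoeff P n) x := by
  refine T.exists_glue
    (fun j x => T.totalFlux M u j n x - 1 / (P.εp : ℂ) * deriv (incCoeff P n) x)
    (fun j hj => ?_) (fun j hj => by simp only [hu.flux n hn j hj])
  have hud := uniqueDiffOn_Icc (T.node_lt j hj)
  have h1 : ContDiff ℝ 1 (deriv (incCoeff P n)) :=
    (contDiff_infty_iff_deriv.1 (contDiff_incCoeff n)).2.of_le (by exact_mod_cast le_top)
  refine ContDiffOn.sub (ContDiffOn.sum fun m hm => contDiffOn_const.mul ?_)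
    (contDiff_const.mul h1).contDiffOn
  -- Being C² up to the ends of the slice, u m has a one-sided derivative that is C¹ there.
  refine ContDiffOn.derivWithin (n := 2) ?_ hud (by norm_num)
  exact (hu.contDiffOn m hm j hj).add
    (contDiff_infty.1 (contDiff_incCoeff m) 2).contDiffOn

section Slice

variable (hu : T.IsSolution M u r t) {n : ℤ} (hn : n ∈ Finset.Icc (-(M : ℤ)) M) {F : ℝ → ℂ}
  {j : ℕ} (hj : j < T.S)
  (hF : ∀ x ∈ Set.Icc (T.node j) (T.node (j + 1)),
    F x = T.totalFlux M u j n x - 1 / (P.εp : ℂ) * deriv (incCoeff P n) x)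
  {y : ℝ} (hy : y ∈ Set.Ioo (T.node j) (T.node (j + 1)))
include hu hj hF hy

lemma Mesh.IsSolution.scatteredFlux_eq :
    F y = ∑ m ∈ Finset.Icc (-(M : ℤ)) M,
        T.invεCoeff j (n - m) * (deriv (u m) y + deriv (incCoeff P m) y)
      - 1 / (P.εp : ℂ) * deriv (incCoeff P n) y := by
  rw [hF y (Set.Ioo_subset_Icc_self hy), Mesh.totalFlux]
  congr 1
  refine Finset.sum_congr rfl fun m hm => ?_
  have hnhds := Icc_mem_nhds hy.1 hy.2
  rw [derivWithin_of_mem_nhds hnhds]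
  congr 1
  exact deriv_fun_add
    (((hu.contDiffOn m hm j hj).differentiableOn (by norm_num)).differentiableAt hnhds)
    ((contDiff_incCoeff m).differentiable (by simp) y)

lemma Mesh.IsSolution.deriv_scatteredFlux_eq :
    deriv F y = ∑ m ∈ Finset.Icc (-(M : ℤ)) M,
        T.invεCoeff j (n - m) * (deriv (deriv (u m)) y + deriv (deriv (incCoeff P m)) y)
      - 1 / (P.εp : ℂ) * deriv (deriv (incCoeff P n)) y := by
  have hev : F =ᶠ[𝓝 y] fun y => ∑ m ∈ Finset.Icc (-(M : ℤ)) M,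
        T.invεCoeff j (n - m) * (deriv (u m) y + deriv (incCoeff P m) y)
      - 1 / (P.εp : ℂ) * deriv (incCoeff P n) y := by
    filter_upwards [Ioo_mem_nhds hy.1 hy.2] with z hz
    exact hu.scatteredFlux_eq hj hF hz
  rw [hev.deriv_eq]
  have hd : ∀ m : ℤ, HasDerivAt (deriv (incCoeff P m)) (deriv (deriv (incCoeff P m)) y) y :=
    fun m => ((contDiff_infty_iff_deriv.1 (contDiff_incCoeff m)).2.differentiable
      (by simp) y).hasDerivAt
  have hdu : ∀ m ∈ Finset.Icc (-(M : ℤ)) M,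
      HasDerivAt (deriv (u m)) (deriv (deriv (u m)) y) y := by
    intro m hm
    have h := ((hu.contDiffOn m hm j hj).mono Set.Ioo_subset_Icc_self).deriv_of_isOpen (m := 1)
      isOpen_Ioo (by norm_num)
    exact ((h.differentiableOn (by norm_num)).differentiableAt
      (Ioo_mem_nhds hy.1 hy.2)).hasDerivAt
  exact ((HasDerivAt.fun_sum fun m hm => ((hdu m hm).add (hd m)).const_mul _).sub
    ((hd n).const_mul _)).deriv

include hn in
/-- The differential equations in divergence form. -/
lemma Mesh.IsSolution.deriv_scatteredFlux_add :
    deriv F y + (P.κ : ℂ) ^ 2 * u n y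
      = -(I * α P n) * (∑ m ∈ Finset.Icc (-(M : ℤ)) M,
          T.invεCoeff j (n - m) * (I * α P m * u m y + I * α P m * incCoeff P m y)
        - 1 / (P.εp : ℂ) * (I * α P n * incCoeff P n y)) := by
  have hode := hu.ode n hn j hj y hy
  rw [T.sourceCoeff_eq j hn] at hode
  rw [hu.deriv_scatteredFlux_eq hj hF hy]
  simp only [mul_add, Finset.sum_add_distrib]
  rw [hode]
  -- α_n α_m = -(iα_n)(iα_m).
  have hI : (α P n : ℂ) * ∑ m ∈ Finset.Icc (-(M : ℤ)) M, T.invεCoeff j (n - m) * (α P m * u m y)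
      = -(I * α P n) * ∑ m ∈ Finset.Icc (-(M : ℤ)) M,
          T.invεCoeff j (n - m) * (I * α P m * u m y) := by
    rw [Finset.mul_sum, Finset.mul_sum]
    refine Finset.sum_congr rfl fun m _ => ?_
    linear_combination (α P n * (T.invεCoeff j (n - m) * (α P m * u m y))) * I_mul_I
  rw [hI]
  ring

end Slice

/-- The `n`-th coefficient of `ε_h⁻¹ w - (ε₊⁻¹ - ε_h⁻¹) z` inside a slice. -/
lemma qpCoeff_flux {g g' : ℤ → ℝ → ℂ} {n : ℤ} (hn : n ∈ Finset.Icc (-(M : ℤ)) M) {j : ℕ}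
    (hj : j < T.S) {y : ℝ} (hy : y ∈ Set.Ioo (T.node j) (T.node (j + 1))) :
    qpCoeff P n (fun x => 1 / T.εh (x, y) * field P M g (x, y)
        - (1 / (P.εp : ℂ) - 1 / T.εh (x, y)) * field P M g' (x, y))
      = ∑ m ∈ Finset.Icc (-(M : ℤ)) M, T.invεCoeff j (n - m) * (g m y + g' m y)
        - 1 / (P.εp : ℂ) * g' n y := by
  have h : ∀ x, T.εh (x, y) = T.sliceε j x := fun x => T.εh_eq hj (x := (x, y)) hy
  simp only [h]
  rw [qpCoeff_sub, T.qpCoeff_one_div_sliceε_mul_field, T.qpCoeff_contrast_mul_field j _ hn]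
  · simp only [mul_add, Finset.sum_add_distrib]
    ring
  · exact memLp_one_div_sliceε_mul_field j g y
  · simp only [sub_mul]
    exact ((memLp_field_slice g' y).const_mul _).sub (memLp_one_div_sliceε_mul_field j g' y)

/-- A finite modal sum has no coefficients beyond |n| ≤ M, so the series is a finite sum. -/
lemma dtnPairing_field (e : ℝ) (c : ℝ) (ψ : ℝ → ℂ) :
    dtnPairing P e (fun x₁ => field P M u (x₁, c)) ψ
      = P.L * ∑ n ∈ Finset.Icc (-(M : ℤ)) M,
          I / e * β P e n * u n c * conj (qpCoeff P n ψ) := by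
  rw [dtnPairing, tsum_eq_sum (s := Finset.Icc (-(M : ℤ)) M)]
  · congr 1
    refine Finset.sum_congr rfl fun n hn => ?_
    rw [qpCoeff_field, if_pos hn]
  · intro n hn
    rw [qpCoeff_field, if_neg hn]
    ring

lemma integral_field_mul_conj (g : ℤ → ℝ → ℂ) (c : ℝ) {ψ : ℝ → ℂ} (hψ : MemLp ψ 2 (volΓ P)) :
    ∫ x, field P M g (x, c) * conj (ψ x) ∂(volΓ P)
      = P.L * ∑ n ∈ Finset.Icc (-(M : ℤ)) M, g n c * conj (qpCoeff P n ψ) := by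
  simp only [field, Finset.sum_mul, Finset.mul_sum]
  rw [integral_finsetSum _ fun n _ =>
    integrable_mul_conj_of_memLp_two ((memLp_mode P n).const_mul (g n c)) hψ]
  refine Finset.sum_congr rfl fun n _ => ?_
  rw [mul_left_comm, L_mul_conj_qpCoeff, ← integral_const_mul]
  simp only [mul_assoc]

lemma memLp_contrast_mul {f : ℝ × ℝ → ℂ} (hf : MemLp f 2 (volΩ P)) :
    MemLp (fun x => (1 / (P.εp : ℂ) - 1 / T.εh x) * f x) 2 (volΩ P) := by
  simp only [sub_mul]
  exact (hf.const_mul _).sub (memLp_one_div_εh_mul hf)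

/-- The volume terms of `B(U,v) - f(v)` reduce to the boundary values of the scattered flux. -/
lemma Mesh.IsSolution.volume_terms (hu : T.IsSolution M u r t) {U v : H1qp P}
    (hU : U.val = field P M u) (hU₁ : U.d₁ = field P M (fun n x₂ => I * α P n * u n x₂))
    (hU₂ : U.d₂ = field P M (fun n => deriv (u n))) (hv : v ∈ V P M)
    {F : ℤ → ℝ → ℂ} (hFc : ∀ n ∈ Finset.Icc (-(M : ℤ)) M, T.PiecewiseC1 (F n))
    (hF : ∀ n ∈ Finset.Icc (-(M : ℤ)) M, ∀ j < T.S, ∀ x ∈ Set.Icc (T.node j) (T.node (j + 1)),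
      F n x = T.totalFlux M u j n x - 1 / (P.εp : ℂ) * deriv (incCoeff P n) x) :
    (∫ x in Omega P, ((1 / T.εh x) * (U.d₁ x * conj (v.d₁ x) + U.d₂ x * conj (v.d₂ x))
        - (P.κ : ℂ) ^ 2 * (U.val x * conj (v.val x))))
      - (∫ x in Omega P, (1 / (P.εp : ℂ) - 1 / T.εh x) *
          (pd₁ (uinc P) x * conj (v.d₁ x) + pd₂ (uinc P) x * conj (v.d₂ x)))
      = P.L * ∑ n ∈ Finset.Icc (-(M : ℤ)) M,
        (F n P.H * conj (qpCoeff P n v.top) - F n (-P.H) * conj (qpCoeff P n v.bot)) := by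
  obtain ⟨ξ, ξ', hξ, hvξ⟩ := exists_field_of_mem_V hv
  have hv₁ := d₁_ae_eq_field (fun n => (hξ n).1) hvξ
  have hv₂ := d₂_ae_eq_field hξ hvξ
  have hinc₁ : MemLp (pd₁ (uinc P)) 2 (volΩ P) := by
    refine continuous_memLp_volΩ (continuous_pd₁ ?_)
    rw [uinc_eq_field 0]
    exact (isSmoothQP_field contDiff_incCoeff).1
  have hinc₂ : MemLp (pd₂ (uinc P)) 2 (volΩ P) := by
    refine continuous_memLp_volΩ (continuous_pd₂ ?_)
    rw [uinc_eq_field 0]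
    exact (isSmoothQP_field contDiff_incCoeff).1
  -- K = (K₁, K₂) is the field ε_h⁻¹∇u - (ε₊⁻¹ - ε_h⁻¹)∇u^inc, which collects the gradient terms of
  -- both volume integrals.
  set K₁ : ℝ × ℝ → ℂ := fun x =>
    1 / T.εh x * U.d₁ x - (1 / (P.εp : ℂ) - 1 / T.εh x) * pd₁ (uinc P) x with hK₁
  set K₂ : ℝ × ℝ → ℂ := fun x =>
    1 / T.εh x * U.d₂ x - (1 / (P.εp : ℂ) - 1 / T.εh x) * pd₂ (uinc P) x with hK₂
  have mU₁ := memLp_one_div_εh_mul (T := T) U.memLp_d₁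
  have mU₂ := memLp_one_div_εh_mul (T := T) U.memLp_d₂
  have mi₁ := memLp_contrast_mul (T := T) hinc₁
  have mi₂ := memLp_contrast_mul (T := T) hinc₂
  have hmK₁ : MemLp K₁ 2 (volΩ P) := mU₁.sub mi₁
  have hmK₂ : MemLp K₂ 2 (volΩ P) := mU₂.sub mi₂
  have iU : Integrable (fun x => (1 / T.εh x) * (U.d₁ x * conj (v.d₁ x) + U.d₂ x * conj (v.d₂ x))
        - (P.κ : ℂ) ^ 2 * (U.val x * conj (v.val x))) (volΩ P) := by
    simp only [mul_add, ← mul_assoc (1 / T.εh _)]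
    exact ((integrable_mul_conj_of_memLp_two mU₁ v.memLp_d₁).add
      (integrable_mul_conj_of_memLp_two mU₂ v.memLp_d₂)).sub
      ((integrable_mul_conj_of_memLp_two U.memLp_val v.memLp_val).const_mul _)
  have ii : Integrable (fun x => (1 / (P.εp : ℂ) - 1 / T.εh x) *
      (pd₁ (uinc P) x * conj (v.d₁ x) + pd₂ (uinc P) x * conj (v.d₂ x))) (volΩ P) := by
    simp only [mul_add, ← mul_assoc (1 / (P.εp : ℂ) - 1 / T.εh _)]
    exact (integrable_mul_conj_of_memLp_two mi₁ v.memLp_d₁).add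
      (integrable_mul_conj_of_memLp_two mi₂ v.memLp_d₂)
  have hsplit : (∫ x in Omega P, ((1 / T.εh x) * (U.d₁ x * conj (v.d₁ x) + U.d₂ x * conj (v.d₂ x))
        - (P.κ : ℂ) ^ 2 * (U.val x * conj (v.val x))))
      - (∫ x in Omega P, (1 / (P.εp : ℂ) - 1 / T.εh x) *
          (pd₁ (uinc P) x * conj (v.d₁ x) + pd₂ (uinc P) x * conj (v.d₂ x)))
      = ∫ x, K₁ x * conj (v.d₁ x) ∂(volΩ P) + ∫ x, K₂ x * conj (v.d₂ x) ∂(volΩ P)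
        - (P.κ : ℂ) ^ 2 * ∫ x, U.val x * conj (v.val x) ∂(volΩ P) := by
    have j₁ := integrable_mul_conj_of_memLp_two hmK₁ v.memLp_d₁
    have j₂ := integrable_mul_conj_of_memLp_two hmK₂ v.memLp_d₂
    have j₀ := (integrable_mul_conj_of_memLp_two U.memLp_val v.memLp_val).const_mul
      ((P.κ : ℂ) ^ 2)
    rw [← integral_const_mul, ← integral_add j₁ j₂]
    refine (integral_sub iU ii).symm.trans (Eq.trans ?_ (integral_sub (j₁.add j₂) j₀))
    refine integral_congr_ae (Eventually.of_forall fun x => ?_)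
    simp only [hK₁, hK₂]
    ring
  have hmξ : ∀ n ∈ Finset.Icc (-(M : ℤ)) M, MemLp (ξ n) 2 (volI P) := fun n _ => (hξ n).1
  have hmξ' : ∀ n ∈ Finset.Icc (-(M : ℤ)) M, MemLp (ξ' n) 2 (volI P) := fun n _ => (hξ n).2.1
  rw [hsplit, integral_congr_ae (hv₁.mono fun x hx => congrArg (K₁ x * conj ·) hx),
    integral_congr_ae (hv₂.mono fun x hx => congrArg (K₂ x * conj ·) hx),
    integral_congr_ae (hvξ.mono fun x hx => congrArg (U.val x * conj ·) hx),
    integral_mul_conj_field hmK₁ fun n _ => (hξ n).1.const_mul _,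
    integral_mul_conj_field hmK₂ hmξ', integral_mul_conj_field U.memLp_val hmξ,
    mul_left_comm, ← mul_add, ← mul_sub, Finset.mul_sum, ← Finset.sum_add_distrib,
    ← Finset.sum_sub_distrib]
  have hL : (P.L : ℂ) ≠ 0 := by exact_mod_cast P.L_pos.ne'
  congr 1
  refine Finset.sum_congr rfl fun n hn => ?_
  -- The boundary values of F n against the traces of v become one-dimensional integrals against ξ n
  -- and ξ' n, without identifying the traces with ξ n (±H).
  have hb := v.integral_piecewiseC1_mul_mode (hFc n hn) n
  rw [integral_congr_ae (hvξ.mono fun x hx => congrArg (_ * conj ·) hx),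
    integral_congr_ae (hv₂.mono fun x hx => congrArg (_ * conj ·) hx),
    integral_mode_mul_conj_field (hFc n hn).memLp_deriv hmξ hn,
    integral_mode_mul_conj_field (hFc n hn).memLp hmξ' hn, ← mul_add] at hb
  rw [← mul_left_cancel₀ hL hb]
  -- Almost everywhere in x₂, the n-th coefficient of K₂ is F n. In `e1`, conjugation moves -iα_n
  -- onto that of K₁, and the divergence form gives (F n)' + κ² u n.
  have e2 : ∫ y, qpCoeff P n (fun x => K₂ (x, y)) * conj (ξ' n y) ∂(volI P)
      = ∫ y, F n y * conj (ξ' n y) ∂(volI P) := by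
    refine integral_congr_ae ?_
    filter_upwards [T.ae_mem_slice] with y ⟨j, hj, hy⟩
    simp only [hK₂, hU₂, pd₂_uinc M]
    rw [qpCoeff_flux hn hj hy, ← hu.scatteredFlux_eq hj (hF n hn j hj) hy]
  have e1 : ∫ y, qpCoeff P n (fun x => K₁ (x, y)) * conj (I * α P n * ξ n y) ∂(volI P)
      = ∫ y, deriv (F n) y * conj (ξ n y) ∂(volI P)
        + (P.κ : ℂ) ^ 2 * ∫ y, u n y * conj (ξ n y) ∂(volI P) := by
    rw [← integral_const_mul]
    refine Eq.trans ?_ (integral_add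
      (integrable_mul_conj_of_memLp_two (hFc n hn).memLp_deriv (hmξ n hn))
      ((integrable_mul_conj_of_memLp_two (hu.piecewiseC1 hn).memLp (hmξ n hn)).const_mul _))
    refine integral_congr_ae ?_
    filter_upwards [T.ae_mem_slice] with y ⟨j, hj, hy⟩
    simp only [hK₁, hU₁, pd₁_uinc M]
    rw [qpCoeff_flux hn hj hy, ← mul_assoc ((P.κ : ℂ) ^ 2), ← add_mul,
      hu.deriv_scatteredFlux_add hn hj (hF n hn j hj) hy]
    simp only [map_mul, conj_I, conj_ofReal]
    ring
  have e0 : ∫ y, qpCoeff P n (fun x => U.val (x, y)) * conj (ξ n y) ∂(volI P)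
      = ∫ y, u n y * conj (ξ n y) ∂(volI P) := by
    simp only [hU, qpCoeff_field, if_pos hn]
  rw [e1, e2, e0]
  ring

theorem Mesh.IsSolution.galerkin (hu : T.IsSolution M u r t) {U v : H1qp P}
    (hU : U.val = field P M u) (hU₁ : U.d₁ = field P M (fun n x₂ => I * α P n * u n x₂))
    (hU₂ : U.d₂ = field P M (fun n => deriv (u n)))
    (htop : U.top = fun x₁ => field P M u (x₁, P.H))
    (hbot : U.bot = fun x₁ => field P M u (x₁, -P.H)) (hv : v ∈ V P M) :
    B P T.εh U v = source P T.εh v := by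
  have hex : ∀ n : ℤ, ∃ F : ℝ → ℂ, n ∈ Finset.Icc (-(M : ℤ)) M → T.PiecewiseC1 F ∧
      ∀ j < T.S, ∀ x ∈ Set.Icc (T.node j) (T.node (j + 1)),
        F x = T.totalFlux M u j n x - 1 / (P.εp : ℂ) * deriv (incCoeff P n) x := by
    intro n
    by_cases hn : n ∈ Finset.Icc (-(M : ℤ)) M
    · obtain ⟨F, hF⟩ := hu.exists_scatteredFlux hn
      exact ⟨F, fun _ => hF⟩
    · exact ⟨0, fun h => absurd h hn⟩
  choose F hF using hex
  have hvol := hu.volume_terms hU hU₁ hU₂ hv (fun n hn => (hF n hn).1) (fun n hn => (hF n hn).2)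
  -- At H the outer medium is ε₊, so the incident flux cancels and the Dirichlet-to-Neumann symbol
  -- remains. The last slice has index S - 1.
  have hFtop : ∀ n ∈ Finset.Icc (-(M : ℤ)) M, F n P.H = I / P.εp * β P P.εp n * u n P.H := by
    intro n hn
    have hS : T.S - 1 + 1 = T.S := Nat.sub_add_cancel T.S_pos
    have hlt : T.S - 1 < T.S := by have := T.S_pos; omega
    have hmem : P.H ∈ Set.Icc (T.node (T.S - 1)) (T.node (T.S - 1 + 1)) := by
      rw [hS, T.node_last]; exact ⟨T.node_le_H hlt.le, le_rfl⟩
    have hr : u n P.H = r n := by linear_combination hu.top_val n hn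
    rw [(hF n hn).2 _ hlt _ hmem, hu.top_flux n hn, hr]
    ring
  -- At -H the outer medium is ε₋: the incident fluxes leave a remainder with factor ε₊⁻¹ - ε₋⁻¹,
  -- matching the boundary integral in `source`.
  have hFbot : ∀ n ∈ Finset.Icc (-(M : ℤ)) M, F n (-P.H)
      = -((1 / (P.εp : ℂ) - 1 / (P.εm : ℂ)) * deriv (incCoeff P n) (-P.H))
        - I / P.εm * β P P.εm n * u n (-P.H) := by
    intro n hn
    have hmem : -P.H ∈ Set.Icc (T.node 0) (T.node (0 + 1)) := by
      rw [T.node_zero]; exact ⟨le_rfl, T.neg_H_le_node T.S_pos⟩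
    have ht : u n (-P.H) = t n := by linear_combination hu.bot_val n hn
    rw [(hF n hn).2 0 T.S_pos _ hmem, hu.bot_flux n hn, ht]
    ring
  have hsrc : ∫ x₁ in Set.Ioo 0 P.L,
        (1 / (P.εp : ℂ) - 1 / (P.εm : ℂ)) * pd₂ (uinc P) (x₁, -P.H) * conj (v.bot x₁)
      = (1 / (P.εp : ℂ) - 1 / (P.εm : ℂ)) * (P.L * ∑ n ∈ Finset.Icc (-(M : ℤ)) M,
          deriv (incCoeff P n) (-P.H) * conj (qpCoeff P n v.bot)) := by
    rw [← integral_field_mul_conj _ _ v.memLp_bot, pd₂_uinc M, ← integral_const_mul]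
    simp only [mul_assoc]
    rfl
  rw [← sub_eq_zero]
  simp only [B, source, htop, hbot, dtnPairing_field, hsrc, sub_self, zero_mul, integral_zero]
  rw [Finset.sum_congr rfl fun n hn => by rw [hFtop n hn, hFbot n hn]] at hvol
  rw [sub_eq_iff_eq_add] at hvol
  rw [hvol]
  simp only [sub_mul, neg_mul, Finset.sum_sub_distrib, Finset.sum_neg_distrib, mul_assoc,
    ← Finset.mul_sum]
  ring

end Galerkin

end RCWA

end

theorem theorem7 (P : RCWA.Grating) (T : RCWA.Mesh P) (M : ℕ)
    (u : ℤ → ℝ → ℂ) (r t : ℤ → ℂ) (hu : T.IsSolution M u r t) :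
    ∃ U : RCWA.H1qp P, U.val = RCWA.field P M u ∧ U ∈ RCWA.V P M ∧
      ∀ v ∈ RCWA.V P M, RCWA.B P T.εh U v = RCWA.source P T.εh v := by
  obtain ⟨U, hU, hU₁, hU₂, htop, hbot⟩ :=
    RCWA.exists_H1qp_field (T := T) fun n hn => hu.piecewiseC1 hn
  refine ⟨U, hU, ⟨RCWA.field P M u, RCWA.field_mem_span fun n hn =>
    (hu.piecewiseC1 hn).memH1Interval, ?_⟩, fun v hv => hu.galerkin hU hU₁ hU₂ htop hbot hv⟩
  rw [hU]
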